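/- **Setting.** Let $\gamma>1$, $\wp(\rho)=\rho^\gamma$, $h_\gamma(\rho)=\rho^\gamma/(\gamma-1)$. Let $\Omega\subset\mathbb R^d$ be a bounded open set, the interior of the union of the cells of a fixed MAC grid: a finite conforming family $\mathcal M$ of (possibly non-uniform) closed boxes $K$ with faces orthogonal to the axes. $\mathcal E^{(i)}_{\rm int}$ is the set of internal faces $\sigma=K|L$ orthogonal to $e^{(i)}$ ($K$ on the $-e^{(i)}$ side, $L$ on the $+e^{(i)}$ side). The dual cell $D_\sigma=D_{\sigma,K}\cup D_{\sigma,L}$ is the union of the adjacent half cells. $L_{\mathcal M}(\Omega)$ is the space of families $(q_K)_{K\in\mathcal M}$ (piecewise constant functions), and $\boldsymbol H_{\mathcal E,0}(\Omega)$ the space of families $(v_\sigma)$ over the internal faces, extended by $0$ to external faces. For $\sigma=K|L\in\mathcal E^{(i)}_{\rm int}$ put $$|D_\sigma|q_{D_\sigma}=|D_{\sigma,K}|q_K+|D_{\sigma,L}|q_L,\qquad (\partial_{\mathcal E}^{(i)}q)_\sigma=\frac{|\sigma|}{|D_\sigma|}(q_L-q_K),$$ and for $q>0$ let $q_\sigma=q_K$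 if $q_K=q_L$, and otherwise let $q_\sigma$ be the number with $q_K^\gamma-q_L^\gamma=q_\sigma\,(h_\gamma'(q_K)-h_\gamma'(q_L))$. For $\boldsymbol w\in\boldsymbol H_{\mathcal E,0}(\Omega)$ let $F_{\sigma,K}(q,\boldsymbol w)=|\sigma|q_\sigma w_{\sigma,K}$ with $w_{\sigma,K}=w_\sigma\,e^{(i)}\cdot\nu_{\sigma,K}$ ($\nu_{\sigma,K}$ the unit normal to $\sigma$ outward to $K$), and $F_{\sigma,K}=0$ on external faces; $(\mathrm{div}_{\mathcal M}(q\boldsymbol w))_K=\frac1{|K|}\sum_{\sigma\in\mathcal E(K)}F_{\sigma,K}(q,\boldsymbol w)$. For $\sigma=K|L\in\mathcal E^{(i)}_{\rm int}$, the outward mass flux $F_{\epsilon,\sigma}(q,\boldsymbol w)$ of $D_\sigma$ through its face $\epsilon$ with outward normal $\pm e^{(j)}$ is half the sum of the outward fluxes of $K$ and of $L$ through their faces with outward normal $\pm e^{(j)}$. For $\epsilon=D_\sigma|D_{\sigma'}$, $v_{\epsilon,\rm up}=v_\sigma$ if $F_{\epsilon,\sigma}\ge0$ and $v_{\sigma'}$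 otherwise ($0$ if $\sigma'$ is not internal). Let $\phi$ be continuous on $\overline\Omega$, $C>\phi$ on $\overline\Omega$ a constant, $\tilde\rho(x)=\big(\frac{\gamma-1}{\gamma}(C-\phi(x))\big)^{1/(\gamma-1)}$ the hydrostatic density, $\tilde\rho_K=\frac1{|K|}\int_K\tilde\rho\,dx$, and $\phi_K=C-h_\gamma'(\tilde\rho_K)$. Let $\delta t>0$, $T=N\delta t$, $t^n=n\delta t$, and let $\eta$ be a constant with $\eta>1/\tilde\rho_{D_\sigma}$ for all internal $\sigma$. **Scheme.** For $\varepsilon>0$ and data $(\rho_0,\boldsymbol u_0)$, a numerical solution is a family $(\rho^n,\boldsymbol u^n)_{0\le n\le N}$ in $L_{\mathcal M}(\Omega)\times\boldsymbol H_{\mathcal E,0}(\Omega)$ with $\rho^n_K>0$ for $1\le n\le N$, with $\rho^0_K$ the average of $\rho_0$ over $K$ and $u^0_\sigma$ the average over $D_\sigma$ of the $i$-th component of $\boldsymbol u_0$ ($\sigma\in\mathcal E^{(i)}_{\rm int}$), such that for $0\le n<N$, all $K\in\mathcal M$ and all $\sigma\in\mathcal E^{(i)}_{\rm int}$, $1\le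 i\le d$, with $p^{n+1}_K=(\rho^{n+1}_K)^\gamma$, $$\tfrac1{\delta t}(\rho_K^{n+1}-\rho_K^n)+\tfrac1{|K|}\sum_{\sigma\in\mathcal E(K)}F_{\sigma,K}(\rho^{n+1},\boldsymbol u^n-\delta\boldsymbol u^{n+1})=0,$$ $$\tfrac1{\delta t}(\rho^{n+1}_{D_\sigma}u^{n+1}_\sigma-\rho^n_{D_\sigma}u^n_\sigma)+\tfrac1{|D_\sigma|}\sum_\epsilon F_{\epsilon,\sigma}(\rho^{n+1},\boldsymbol u^n-\delta\boldsymbol u^{n+1})u^n_{\epsilon,\rm up}+\tfrac1{\varepsilon^2}(\partial^{(i)}_{\mathcal E}p^{n+1})_\sigma=-\tfrac1{\varepsilon^2}\rho^{n+1}_\sigma(\partial^{(i)}_{\mathcal E}\phi)_\sigma,$$ $$\delta u^{n+1}_\sigma=\tfrac{\eta\,\delta t}{\varepsilon^2}\big[(\partial^{(i)}_{\mathcal E}p^{n+1})_\sigma+\rho^{n+1}_\sigma(\partial^{(i)}_{\mathcal E}\phi)_\sigma\big].$$ **Theorem.** Let $\varepsilon^{(k)}>0$, $\varepsilon^{(k)}\to0$,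 and let $(\rho^{(k)}_0,\boldsymbol u^{(k)}_0)\in L^\infty(\Omega)^{1+d}$ be well-prepared: $\rho_0^{(k)}>0$ a.e.; $\rho_0^{(k)}=\tilde\rho+\varepsilon^{(k)}r^{(k)}$ with $(r^{(k)})$ bounded in $L^\infty(\Omega)$ and $r^{(k)}\to0$ in $L^2(\Omega)$; $\boldsymbol u_0^{(k)}\to\boldsymbol U_0$ in $L^2(\Omega)^d$, where $\mathrm{div}(\tilde\rho\,\boldsymbol U_0)=0$ in the sense of distributions in $\Omega$. For each $k$ let $(\rho^{(k)},\boldsymbol u^{(k)})$ be a numerical solution with $\varepsilon=\varepsilon^{(k)}$ and these data, regarded as a function of time equal to $(\rho^{(k),n},\boldsymbol u^{(k),n})$ on $(t^{n-1},t^n]$, $1\le n\le N$. Then: 1. $\rho^{(k)}\to\tilde\rho=(\tilde\rho_K)_K$ in $L^\infty(0,T;L^r(\Omega))$ for every $r\in(1,\min\{2,\gamma\}]$, and in $L^\infty(0,T;L_{\mathcal M}(\Omega))$ for every norm on $L_{\mathcal M}(\Omega)$; also $\rho^{(k),0}\to\tilde\rho$. 2. There are $(\pi^n,\boldsymbol U^n)\in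 L_{\mathcal M}(\Omega)\times\boldsymbol H_{\mathcal E,0}(\Omega)$, $0\le n\le N$, such that the whole sequence $\boldsymbol u^{(k)}$ converges to $\boldsymbol U$ (equal to $\boldsymbol U^n$ on $(t^{n-1},t^n]$) in $L^\infty(0,T;\boldsymbol H_{\mathcal E,0}(\Omega))$ for every norm on $\boldsymbol H_{\mathcal E,0}(\Omega)$; also $\boldsymbol u^{(k),0}\to\boldsymbol U^0$. Here $U^0_\sigma$ is the average over $D_\sigma$ of the $i$-th component of $\boldsymbol U_0$ ($\sigma\in\mathcal E_{\rm int}^{(i)}$), and for $0\le n<N$ the pair $(\pi^{n+1},\boldsymbol U^{n+1})$ solves the velocity stabilised semi-implicit scheme for the anelastic Euler system: for all $K\in\mathcal M$ and all $\sigma\in\mathcal E^{(i)}_{\rm int}$, $1\le i\le d$, $$(\mathrm{div}_{\mathcal M}(\tilde\rho(\boldsymbol U^n-\delta\boldsymbol U^{n+1})))_K=0,$$ $$\tfrac1{\delta t}\tilde\rho_{D_\sigma}(U^{n+1}_\sigma-U^n_\sigma)+\tfrac1{|D_\sigma|}\sum_\epsilon F_{\epsilon,\sigma}(\tilde\rho,\boldsymbol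 U^n-\delta\boldsymbol U^{n+1})U^n_{\epsilon,\rm up}+\tilde\rho_\sigma(\partial^{(i)}_{\mathcal E}\pi^{n+1})_\sigma=0,$$ with the correction $\delta U^{n+1}_\sigma=\eta\,\delta t\,\tilde\rho_\sigma(\partial^{(i)}_{\mathcal E}\pi^{n+1})_\sigma$. -/

import Mathlib

open MeasureTheory Filter Topology Set
open scoped ENNReal ContDiff

noncomputable section

/-! ### Barotropic pressure law and interface densities -/

/-- The Helmholtz function `h_γ(ρ) = ρ^γ / (γ - 1)`. -/
def helmholtz (γ ρ : ℝ) : ℝ := ρ ^ γ / (γ - 1)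

/-- The derivative `h_γ'(ρ) = γ / (γ - 1) * ρ^(γ - 1)` of the Helmholtz function. -/
def helmholtzDeriv (γ ρ : ℝ) : ℝ := γ / (γ - 1) * ρ ^ (γ - 1)

theorem hasDerivAt_helmholtz {γ ρ : ℝ} (hρ : 0 < ρ) :
    HasDerivAt (helmholtz γ) (helmholtzDeriv γ ρ) ρ := by
  have h := (Real.hasDerivAt_rpow_const (x := ρ) (p := γ) (Or.inl hρ.ne')).div_const (γ - 1)
  have e : γ * ρ ^ (γ - 1) / (γ - 1) = helmholtzDeriv γ ρ := by
    unfold helmholtzDeriv; ring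
  rw [e] at h
  exact h

/-- The interface density `ρ_{KL}` of two positive densities `a = ρ_K`, `b = ρ_L`: the solution of
`a^γ - b^γ = ρ_{KL} (h_γ'(a) - h_γ'(b))` if `a ≠ b`, and the common value if `a = b`. -/
def interfaceDensity (γ a b : ℝ) : ℝ :=
  open Classical in
  if a = b then a else (a ^ γ - b ^ γ) / (helmholtzDeriv γ a - helmholtzDeriv γ b)

/-- The interface density is characterised by its defining relation. -/
theorem interfaceDensity_iff {γ a b c : ℝ} (hγ : 1 < γ) (ha : 0 < a) (hb : 0 < b) (hab : a ≠ b) :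
    c = interfaceDensity γ a b ↔
      a ^ γ - b ^ γ = c * (helmholtzDeriv γ a - helmholtzDeriv γ b) := by
  have hne : helmholtzDeriv γ a - helmholtzDeriv γ b ≠ 0 := by
    unfold helmholtzDeriv
    rw [← mul_sub]
    refine mul_ne_zero (div_ne_zero (by linarith) (by linarith)) (sub_ne_zero.2 ?_)
    intro h
    exact hab ((Real.rpow_left_inj ha.le hb.le (by linarith)).1 h)
  rw [interfaceDensity, if_neg hab, eq_div_iff hne, eq_comm]

/-- The hydrostatic density `ρ̃(x)`, i.e. the positive solution of `h_γ'(ρ̃) + φ = C`. -/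
def hydroDensity {d : ℕ} (γ C : ℝ) (φ : (Fin d → ℝ) → ℝ) (x : Fin d → ℝ) : ℝ :=
  ((γ - 1) / γ * (C - φ x)) ^ (1 / (γ - 1))

/-! ### MAC grids -/

/-- A conforming, possibly non-uniform mesh made of nondegenerate closed boxes of `ℝ^d` with faces
orthogonal to the coordinate axes; `M` indexes the primal cells. Distinct cells have disjoint
interiors, and two cells that meet do so along a common face (of some dimension): in every
coordinate direction their edges coincide or are end to end. -/
structure MACGrid (d : ℕ) (M : Type*) where
  cell : M → BoxIntegral.Box (Fin d)
  disjoint : ∀ K L, K ≠ L →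
    Disjoint (BoxIntegral.Box.Ioo (cell K)) (BoxIntegral.Box.Ioo (cell L))
  conforming : ∀ K L,
    (BoxIntegral.Box.Icc (cell K) ∩ BoxIntegral.Box.Icc (cell L)).Nonempty → ∀ i,
      ((cell K).lower i = (cell L).lower i ∧ (cell K).upper i = (cell L).upper i) ∨
        (cell K).upper i = (cell L).lower i ∨ (cell L).upper i = (cell K).lower i

namespace MACGrid

variable {d : ℕ} {M : Type*}

/-- The closed cell `K`. -/
def closedCell (G : MACGrid d M) (K : M) : Set (Fin d → ℝ) := BoxIntegral.Box.Icc (G.cell K)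

/-- The computational domain `Ω`: the open set meshed by the cells. -/
def domain (G : MACGrid d M) : Set (Fin d → ℝ) := interior (⋃ K, G.closedCell K)

/-- `L` is the cell adjacent to `K` in the direction `+e_i` (they share a full face). -/
def IsNext (G : MACGrid d M) (i : Fin d) (K L : M) : Prop :=
  (G.cell K).upper i = (G.cell L).lower i ∧
    ∀ j, j ≠ i → (G.cell K).lower j = (G.cell L).lower j ∧
      (G.cell K).upper j = (G.cell L).upper j

/-- The neighbour of a cell in a given direction is unique. -/
theorem IsNext.unique {G : MACGrid d M} {i : Fin d} {K L L' : M}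
    (h : G.IsNext i K L) (h' : G.IsNext i K L') : L = L' := by
  by_contra hne
  have hlo : (G.cell L).lower = (G.cell L').lower := by
    funext j
    by_cases hj : j = i
    · subst hj; rw [← h.1, h'.1]
    · rw [← (h.2 j hj).1, (h'.2 j hj).1]
  have hmem : (BoxIntegral.Box.Icc (G.cell L) ∩ BoxIntegral.Box.Icc (G.cell L')).Nonempty :=
    ⟨(G.cell L).lower, (G.cell L).lower_mem_Icc, by rw [hlo]; exact (G.cell L').lower_mem_Icc⟩
  have hup : (G.cell L).upper = (G.cell L').upper := by
    funext j
    have hl := (G.cell L).lower_lt_upper j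
    have hl' := (G.cell L').lower_lt_upper j
    have e := congrFun hlo j
    rcases G.conforming L L' hmem j with hc | hc | hc
    · exact hc.2
    · linarith
    · linarith
  have heq : G.cell L = G.cell L' := BoxIntegral.Box.ext_iff.2 fun x => by
    simp only [BoxIntegral.Box.mem_def, hlo, hup]
  have hd := G.disjoint L L' hne
  rw [heq, disjoint_self] at hd
  have hx : (fun j => ((G.cell L').lower j + (G.cell L').upper j) / 2) ∈
      BoxIntegral.Box.Ioo (G.cell L') := by
    intro j _
    have := (G.cell L').lower_lt_upper j
    constructor <;> dsimp only <;> linarith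
  rw [hd] at hx
  exact hx

/-- The internal faces `σ = K|L`: a direction `i`, with `K` and `L` the cells on the `-e_i` and on
the `+e_i` side of `σ`. The external faces carry zero velocity, zero gradient and zero flux, and
need not be represented. -/
def Face (G : MACGrid d M) : Type _ :=
  {p : Fin d × M × M // G.IsNext p.1 p.2.1 p.2.2}

instance (G : MACGrid d M) [Fintype M] : Fintype G.Face :=
  open Classical in inferInstanceAs (Fintype {p : Fin d × M × M // G.IsNext p.1 p.2.1 p.2.2})

variable {G : MACGrid d M}

/-- The direction to which a face is orthogonal. -/
def Face.dir (σ : G.Face) : Fin d := σ.1.1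

/-- The cell `K` on the negative side of `σ`. -/
def Face.lower (σ : G.Face) : M := σ.1.2.1

/-- The cell `L` on the positive side of `σ`. -/
def Face.upper (σ : G.Face) : M := σ.1.2.2

/-- The half `D_{σ,K}` of the dual cell inside the lower cell. -/
def Face.lowerHalf (σ : G.Face) : Set (Fin d → ℝ) :=
  {x | x ∈ G.closedCell σ.lower ∧
    ((G.cell σ.lower).lower σ.dir + (G.cell σ.lower).upper σ.dir) / 2 ≤ x σ.dir}

/-- The half `D_{σ,L}` of the dual cell inside the upper cell. -/
def Face.upperHalf (σ : G.Face) : Set (Fin d → ℝ) :=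
  {x | x ∈ G.closedCell σ.upper ∧
    x σ.dir ≤ ((G.cell σ.upper).lower σ.dir + (G.cell σ.upper).upper σ.dir) / 2}

/-- The dual cell `D_σ`. -/
def Face.dualCell (σ : G.Face) : Set (Fin d → ℝ) := σ.lowerHalf ∪ σ.upperHalf

/-- The `(d-1)`-dimensional measure `|σ|`. -/
def Face.area (σ : G.Face) : ℝ :=
  ∏ j ∈ Finset.univ.erase σ.dir, ((G.cell σ.lower).upper j - (G.cell σ.lower).lower j)

/-- `|K|`. -/
def vol (G : MACGrid d M) (K : M) : ℝ := volume.real (G.closedCell K)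

/-- `|D_σ|`. -/
def Face.vol (σ : G.Face) : ℝ := volume.real σ.dualCell

/-! The space `L_M(Ω)` is `M → ℝ`, and `H_{E,0}(Ω)` is `G.Face → ℝ`. -/

/-- The piecewise constant function `∑ q_K χ_K` associated with `q ∈ L_M(Ω)`. -/
def toFun [Fintype M] (G : MACGrid d M) (q : M → ℝ) (x : Fin d → ℝ) : ℝ :=
  ∑ K, (G.closedCell K).indicator (fun _ => q K) x

/-- Cell averages of a scalar function. -/
def cellAvg (G : MACGrid d M) (f : (Fin d → ℝ) → ℝ) (K : M) : ℝ := ⨍ x in G.closedCell K, f x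

/-- Dual cell averages of a vector field: the `i`-th component is averaged over `D_σ`, for `σ`
orthogonal to `e_i`. -/
def faceAvg (G : MACGrid d M) (v : (Fin d → ℝ) → (Fin d → ℝ)) (σ : G.Face) : ℝ :=
  ⨍ x in σ.dualCell, v x σ.dir

/-- The dual average `q_{D_σ}`, `|D_σ| q_{D_σ} = |D_{σ,K}| q_K + |D_{σ,L}| q_L`. -/
def dualAvg (q : M → ℝ) (σ : G.Face) : ℝ :=
  (volume.real σ.lowerHalf * q σ.lower + volume.real σ.upperHalf * q σ.upper) / σ.vol

/-- The interface value `q_σ = q_{KL}`. -/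
def faceDensity (γ : ℝ) (q : M → ℝ) (σ : G.Face) : ℝ :=
  interfaceDensity γ (q σ.lower) (q σ.upper)

/-- The discrete gradient `(∂^{(i)}_E q)_σ = |σ| / |D_σ| (q_L - q_K)`. -/
def grad (q : M → ℝ) (σ : G.Face) : ℝ := σ.area / σ.vol * (q σ.upper - q σ.lower)

/-- The sign of the outward normal on the side `(j, s)` of a box: `true` is the side `+e_j`,
`false` is the side `-e_j`. -/
def sideSign : Bool → ℝ
  | true => 1
  | false => -1

/-- `σ` is the face of the cell `K` on the side `(j, s)`. -/
def IsFaceOf (σ : G.Face) (K : M) (j : Fin d) : Bool → Prop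
  | true => σ.dir = j ∧ σ.lower = K
  | false => σ.dir = j ∧ σ.upper = K

/-- `L` is the neighbour of the cell `K` across the side `(j, s)`. -/
def IsNeighbour (G : MACGrid d M) (K L : M) (j : Fin d) : Bool → Prop
  | true => G.IsNext j K L
  | false => G.IsNext j L K

variable [Fintype M]

/-- The mass flux `F_{σ,K}(q, w) = |σ| q_σ w_{σ,K}` out of `K` through its face `σ` on the side
`(j, s)`; it is zero if that face is external (there is at most one term in the sum). -/
def massFlux (γ : ℝ) (q : M → ℝ) (w : G.Face → ℝ) (K : M) (j : Fin d) (s : Bool) : ℝ :=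
  open Classical in
  ∑ σ : G.Face, if IsFaceOf σ K j s then σ.area * faceDensity γ q σ * (sideSign s * w σ) else 0

/-- The discrete divergence `(div_M (q w))_K`. -/
def divM (γ : ℝ) (q : M → ℝ) (w : G.Face → ℝ) (K : M) : ℝ :=
  1 / G.vol K * ∑ j : Fin d, ∑ s : Bool, massFlux γ q w K j s

/-- The mass flux `F_{ε,σ}(q, w)` out of the dual cell `D_σ`, `σ = K|L`, through its face `ε` on the
side `(j, s)`. It is half the sum of the outward fluxes of `K` and of `L` through their faces
on the side `(j, s)`. If `e_j` is tangent to `σ`, these two faces are the ones of which `ε` consists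
of halves; if `e_j` is normal to `σ`, then `ε` lies midway between these two faces, one of which is
`σ` itself. -/
def dualFlux (γ : ℝ) (q : M → ℝ) (w : G.Face → ℝ) (σ : G.Face) (j : Fin d) (s : Bool) : ℝ :=
  (massFlux γ q w σ.lower j s + massFlux γ q w σ.upper j s) / 2

/-- The value of `v` on the face `σ'` with `ε = D_σ|D_{σ'}`, `ε` being the face of `D_σ` on the side
`(j, s)`: `σ'` is the translate of `σ` by one cell, and the value is zero if it is not internal
(there is at most one term in the sum). -/
def neighbourVal (v : G.Face → ℝ) (σ : G.Face) (j : Fin d) (s : Bool) : ℝ :=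
  open Classical in
  ∑ σ' : G.Face, if σ'.dir = σ.dir ∧ G.IsNeighbour σ.lower σ'.lower j s ∧
    G.IsNeighbour σ.upper σ'.upper j s then v σ' else 0

/-- The upwind momentum flux `∑_ε F_{ε,σ}(q, w) v_{ε,up}` of `D_σ`. -/
def upwindFlux (γ : ℝ) (q : M → ℝ) (w v : G.Face → ℝ) (σ : G.Face) : ℝ :=
  ∑ j : Fin d, ∑ s : Bool, dualFlux γ q w σ j s *
    (open Classical in if 0 ≤ dualFlux γ q w σ j s then v σ else neighbourVal v σ j s)

/-! ### The schemes -/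

/-- The discrete hydrostatic density `ρ̃_K`. -/
def hydro (G : MACGrid d M) (γ C : ℝ) (φ : (Fin d → ℝ) → ℝ) (K : M) : ℝ :=
  G.cellAvg (hydroDensity γ C φ) K

/-- The discrete potential `φ_K = C - h_γ'(ρ̃_K)`. -/
def potential (G : MACGrid d M) (γ C : ℝ) (φ : (Fin d → ℝ) → ℝ) (K : M) : ℝ :=
  C - helmholtzDeriv γ (G.hydro γ C φ K)

/-- The velocity correction
`δu_σ = η δt / ε² ((∂p)_σ + ρ_σ (∂Φ)_σ)`, `p = ρ^γ`, of the compressible scheme. -/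
def correction (γ η δt ε : ℝ) (Φ ρ : M → ℝ) (σ : G.Face) : ℝ :=
  η * δt / ε ^ 2 * (grad (fun K => ρ K ^ γ) σ + faceDensity γ ρ σ * grad Φ σ)

/-- `(ρ^n, u^n)`, `0 ≤ n ≤ N`, is a numerical solution (with positive densities) of the semi-implicit
scheme for the velocity stabilised Euler system, with the averages of `(ρ0, u0)` as initial
values. -/
structure IsEulerSolution (G : MACGrid d M) (γ C : ℝ) (φ : (Fin d → ℝ) → ℝ) (η δt : ℝ) (N : ℕ)
    (ε : ℝ) (ρ0 : (Fin d → ℝ) → ℝ) (u0 : (Fin d → ℝ) → (Fin d → ℝ))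
    (ρ : ℕ → M → ℝ) (u : ℕ → G.Face → ℝ) : Prop where
  init_density : ρ 0 = G.cellAvg ρ0
  init_velocity : u 0 = G.faceAvg u0
  pos : ∀ n < N, ∀ K, 0 < ρ (n + 1) K
  mass : ∀ n < N, ∀ K,
    1 / δt * (ρ (n + 1) K - ρ n K) +
      1 / G.vol K * ∑ j : Fin d, ∑ s : Bool, massFlux γ (ρ (n + 1))
        (u n - correction γ η δt ε (G.potential γ C φ) (ρ (n + 1))) K j s = 0
  momentum : ∀ n < N, ∀ σ : G.Face,
    1 / δt * (dualAvg (ρ (n + 1)) σ * u (n + 1) σ - dualAvg (ρ n) σ * u n σ) +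
      1 / σ.vol * upwindFlux γ (ρ (n + 1))
        (u n - correction γ η δt ε (G.potential γ C φ) (ρ (n + 1))) (u n) σ +
      1 / ε ^ 2 * grad (fun K => ρ (n + 1) K ^ γ) σ =
    -(1 / ε ^ 2) * faceDensity γ (ρ (n + 1)) σ * grad (G.potential γ C φ) σ

/-- The velocity correction `δU_σ = η δt ρ̃_σ (∂π)_σ` of the anelastic scheme. -/
def anelasticCorrection (γ η δt : ℝ) (ρt π : M → ℝ) (σ : G.Face) : ℝ :=
  η * δt * (faceDensity γ ρt σ * grad π σ)

/-- `(π^n, U^n)` is a solution of the velocity stabilised semi-implicit scheme for the anelastic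
Euler system with background density `ρt`, the initial velocity being the average of `U0`
(`π^0` plays no role). -/
structure IsAnelasticSolution (G : MACGrid d M) (γ : ℝ) (ρt : M → ℝ) (η δt : ℝ) (N : ℕ)
    (U0 : (Fin d → ℝ) → (Fin d → ℝ)) (π : ℕ → M → ℝ) (U : ℕ → G.Face → ℝ) : Prop where
  init_velocity : U 0 = G.faceAvg U0
  mass : ∀ n < N, ∀ K, divM γ ρt (U n - anelasticCorrection γ η δt ρt (π (n + 1))) K = 0
  momentum : ∀ n < N, ∀ σ : G.Face,
    1 / δt * (dualAvg ρt σ * (U (n + 1) σ - U n σ)) +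
      1 / σ.vol * upwindFlux γ ρt
        (U n - anelasticCorrection γ η δt ρt (π (n + 1))) (U n) σ +
      faceDensity γ ρt σ * grad (π (n + 1)) σ = 0

end MACGrid

/-! ### Well-prepared data and time-dependent norms -/

/-- `div (q V) = 0` in the sense of distributions on `Ω`. -/
def IsWeakDivFree {d : ℕ} (Ω : Set (Fin d → ℝ)) (q : (Fin d → ℝ) → ℝ)
    (V : (Fin d → ℝ) → (Fin d → ℝ)) : Prop :=
  ∀ ψ : (Fin d → ℝ) → ℝ, ContDiff ℝ ∞ ψ → HasCompactSupport ψ → tsupport ψ ⊆ Ω →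
    ∫ x in Ω, q x * ∑ i, V x i * fderiv ℝ ψ x (Pi.single i 1) = 0

/-- Well-prepared data along a sequence `ε k`, with limit velocity `U0`; `ρt` is the hydrostatic
density. -/
structure IsWellPrepared {d : ℕ} (Ω : Set (Fin d → ℝ)) (ρt : (Fin d → ℝ) → ℝ) (ε : ℕ → ℝ)
    (ρ0 : ℕ → (Fin d → ℝ) → ℝ) (u0 : ℕ → (Fin d → ℝ) → (Fin d → ℝ))
    (U0 : (Fin d → ℝ) → (Fin d → ℝ)) : Prop where
  density_memLp : ∀ k, MemLp (ρ0 k) ∞ (volume.restrict Ω)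
  velocity_memLp : ∀ k, MemLp (u0 k) ∞ (volume.restrict Ω)
  density_pos : ∀ k, ∀ᵐ x ∂(volume.restrict Ω), 0 < ρ0 k x
  density_expansion : ∃ r : ℕ → (Fin d → ℝ) → ℝ,
    (∀ k, ∀ᵐ x ∂(volume.restrict Ω), ρ0 k x = ρt x + ε k * r k x) ∧
    (∀ k, MemLp (r k) ∞ (volume.restrict Ω)) ∧
    (∃ B : ℝ, ∀ k, ∀ᵐ x ∂(volume.restrict Ω), |r k x| ≤ B) ∧
    Tendsto (fun k => eLpNorm (r k) 2 (volume.restrict Ω)) atTop (𝓝 0)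
  limit_memLp : MemLp U0 2 (volume.restrict Ω)
  velocity_tendsto :
    Tendsto (fun k => eLpNorm (u0 k - U0) 2 (volume.restrict Ω)) atTop (𝓝 0)
  limit_divFree : IsWeakDivFree Ω ρt U0

/-- The piecewise constant function of time with value `f^n` on `(t^{n-1}, t^n]`, `t^n = n δt`. -/
def timeStep {X : Type*} (δt : ℝ) (f : ℕ → X) (t : ℝ) : X := f ⌈t / δt⌉₊

/-- The `L^∞(0,T)` norm of a nonnegative function of time. -/
def supNormTime (T : ℝ) (f : ℝ → ℝ≥0∞) : ℝ≥0∞ := essSup f (volume.restrict (Ioo 0 T))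

end

/-!
The mesh and the number of time steps are fixed, so the limit `ε → 0` takes place in finite
dimension and is carried out one time step at a time, by induction on the time level. The induction
hypothesis is that the density is at distance `O(ε)` from the hydrostatic density `ρ̃` and that the
velocity converges.

The scheme is well balanced (`MACGrid.grad_pressure_add`): by the choice of the interface density
and of the discrete potential, pressure gradient and gravity combine into `ρ_σ ∂P`, where
`P = (h_γ'(ρ) - h_γ'(ρ̃)) / ε²` is the scaled potential. In terms of `P` the compressible scheme has
the shape of the anelastic one. Testing the mass balance with `P` gives an energy estimate
(`MACGrid.energy_estimate`), in which the velocity correction dissipates `(ρ_σ ∂P)²` and thereby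
absorbs the work of the explicit velocity. As `h_γ'` is increasing and bi-Lipschitz near `ρ̃`, the
estimate yields `ρ - ρ̃ = O(ε)` at the new time level and a bound on `∂P` (`MACGrid.step_bounds`).

The discrete gradients form a closed subspace, so every limit point of `∂P` is a gradient `∂π`, and
passing to the limit in the mass balance shows that `π` solves the discrete elliptic problem of the
anelastic scheme. That problem determines `∂π` (`MACGrid.grad_eq_of_divM_eq_zero`), hence the whole
family `∂P` converges. Since the mass fluxes and the upwind fluxes are continuous in the unknowns
at positive densities, the momentum balance then gives the convergence of the new velocity and the
anelastic momentum balance (`MACGrid.step_limit`).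
-/

/-! ### The derivative of the Helmholtz function and the interface density -/

theorem hasDerivAt_helmholtzDeriv {γ x : ℝ} (hγ : 1 < γ) (hx : 0 < x) :
    HasDerivAt (helmholtzDeriv γ) (γ * x ^ (γ - 2)) x := by
  have h := (Real.hasDerivAt_rpow_const (x := x) (p := γ - 1) (Or.inl hx.ne')).const_mul
    (γ / (γ - 1))
  have hγ' : γ - 1 ≠ 0 := by linarith
  have e : γ / (γ - 1) * ((γ - 1) * x ^ (γ - 1 - 1)) = γ * x ^ (γ - 2) := by
    rw [show γ - 1 - 1 = γ - 2 by ring]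
    field_simp
  rw [e] at h
  exact h

theorem helmholtzDeriv_strictMonoOn {γ : ℝ} (hγ : 1 < γ) :
    StrictMonoOn (helmholtzDeriv γ) (Ici 0) := by
  intro x hx y _ hxy
  unfold helmholtzDeriv
  have h := Real.rpow_lt_rpow hx hxy (show 0 < γ - 1 by linarith)
  have : 0 < γ / (γ - 1) := div_pos (by linarith) (by linarith)
  gcongr

/-- `h_γ'` is bi-Lipschitz near a positive density, as `h_γ''` does not vanish there. -/
theorem exists_helmholtzDeriv_bounds {γ a : ℝ} (hγ : 1 < γ) (ha : 0 < a) :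
    ∃ c C δ : ℝ, 0 < c ∧ 0 < C ∧ 0 < δ ∧ δ < a ∧ ∀ x, |x - a| ≤ δ →
      c * |x - a| ≤ |helmholtzDeriv γ x - helmholtzDeriv γ a| ∧
      |helmholtzDeriv γ x - helmholtzDeriv γ a| ≤ C * |x - a| := by
  set f' := γ * a ^ (γ - 2)
  have hf' : 0 < f' := mul_pos (by linarith) (Real.rpow_pos_of_pos ha _)
  have h := (hasDerivAt_iff_isLittleO.1 (hasDerivAt_helmholtzDeriv hγ ha)).def (half_pos hf')
  obtain ⟨r, hr, h⟩ := Metric.eventually_nhds_iff.1 h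
  refine ⟨f' / 2, 2 * f', min (r / 2) (a / 2), by positivity, by positivity, by positivity,
    (min_le_right _ _).trans_lt (by linarith), fun x hx => ?_⟩
  have h1 := h (y := x) (by
    rw [Real.dist_eq]; exact (hx.trans (min_le_left _ _)).trans_lt (by linarith))
  simp only [Real.norm_eq_abs, smul_eq_mul] at h1
  have h2 : |(x - a) * f'| = f' * |x - a| := by rw [abs_mul, abs_of_pos hf', mul_comm]
  have h3 := abs_sub_abs_le_abs_sub ((x - a) * f') (helmholtzDeriv γ x - helmholtzDeriv γ a)
  have h4 := abs_sub_abs_le_abs_sub (helmholtzDeriv γ x - helmholtzDeriv γ a) ((x - a) * f')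
  rw [abs_sub_comm ((x - a) * f')] at h3
  change |_ - (x - a) * f'| ≤ _ at h1
  have h5 : 0 ≤ f' * |x - a| := by positivity
  constructor <;> nlinarith

/-- The convexity of `h_γ` in the form used for the energy estimate: for the exact background
`y = a` the product is nonnegative, and moving `y` away from `a` costs at most `(y - a) ^ 2`. -/
theorem exists_le_sub_mul_helmholtzDeriv_sub {γ a : ℝ} (hγ : 1 < γ) (ha : 0 < a) :
    ∃ C δ : ℝ, 0 < C ∧ 0 < δ ∧ ∀ x y, 0 < x → |y - a| ≤ δ →
      -(C * (y - a) ^ 2) ≤ (x - y) * (helmholtzDeriv γ x - helmholtzDeriv γ a) := by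
  obtain ⟨c, C, δ, -, hC, hδ, -, h⟩ := exists_helmholtzDeriv_bounds hγ ha
  have hm := (helmholtzDeriv_strictMonoOn hγ).monotoneOn
  refine ⟨C, δ, hC, hδ, fun x y hx hy => ?_⟩
  have hsq : 0 ≤ C * (y - a) ^ 2 := by positivity
  rcases le_total a x with hax | hax
  · have h0 := hm ha.le hx.le hax
    rcases le_total y x with hyx | hyx
    · nlinarith [mul_nonneg (sub_nonneg.2 hyx) (sub_nonneg.2 h0)]
    · rw [abs_of_nonneg (by linarith)] at hy
      have h1 := (h x (by rw [abs_of_nonneg (by linarith)]; linarith)).2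
      rw [abs_of_nonneg (by linarith), abs_of_nonneg (by linarith)] at h1
      have h2 : helmholtzDeriv γ x - helmholtzDeriv γ a ≤ C * (y - a) := by nlinarith
      have h3 := mul_le_mul (show y - x ≤ y - a by linarith) h2 (by linarith) (by linarith)
      nlinarith
  · have h0 := hm hx.le ha.le hax
    rcases le_total x y with hyx | hyx
    · nlinarith [mul_nonneg (sub_nonneg.2 hyx) (sub_nonneg.2 h0)]
    · rw [abs_of_nonpos (by linarith)] at hy
      have h1 := (h x (by rw [abs_of_nonpos (by linarith)]; linarith)).2
      rw [abs_of_nonpos (by linarith), abs_of_nonpos (by linarith)] at h1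
      have h2 : helmholtzDeriv γ a - helmholtzDeriv γ x ≤ C * (a - y) := by nlinarith
      have h3 := mul_le_mul (show x - y ≤ a - y by linarith) h2 (by linarith) (by linarith)
      nlinarith

/-- The coercivity of the energy at scale `e`: a product of order `e ^ 2` forces a deviation from
the background of order `e`. -/
theorem exists_abs_sub_le_of_sub_mul_le {γ a B D : ℝ} (hγ : 1 < γ) (ha : 0 < a) (hB : 0 ≤ B)
    (hD : 0 ≤ D) :
    ∃ A δ : ℝ, 0 < δ ∧ ∀ x y e, 0 < x → 0 < e → e ≤ δ → |y - a| ≤ B * e →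
      (x - y) * (helmholtzDeriv γ x - helmholtzDeriv γ a) ≤ D * e ^ 2 → |x - a| ≤ A * e := by
  obtain ⟨c, C, δ, hc, -, hδ, hδa, h⟩ := exists_helmholtzDeriv_bounds hγ ha
  have hm := (helmholtzDeriv_strictMonoOn hγ).monotoneOn
  -- `A` is chosen so that `c * A * (A / 2) > D` and `A - B ≥ A / 2`.
  set A := 2 * B + 2 * (D / c) + 1 with hA
  have hDc : 0 ≤ D / c := by positivity
  have hcD : c * (D / c) = D := by field_simp
  have hApos : 0 < A := by linarith
  have hlarge : D < c * A * (A / 2) := by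
    have : c * A * (D / c + 1 / 2) ≤ c * A * (A / 2) := by gcongr; linarith
    have : c * 1 * (D / c + 1 / 2) ≤ c * A * (D / c + 1 / 2) := by gcongr; linarith
    nlinarith
  refine ⟨A, δ / A, by positivity, fun x y e hx he heδ hy hxy => ?_⟩
  rw [le_div_iff₀ hApos] at heδ
  have hAe : 0 < A * e := by positivity
  have hlarge' : D * e ^ 2 < (A / 2 * e) * (c * (A * e)) := by
    have : 0 < e ^ 2 := by positivity
    nlinarith
  have hBA : (A / 2) * e ≤ A * e - B * e := by nlinarith
  have hy' := abs_le.1 hy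
  by_contra! hlt
  refine absurd hxy (not_le.2 (hlarge'.trans_le ?_))
  rcases lt_abs.1 hlt with h1 | h1
  · have h2 := (h (a + A * e) (by rw [add_sub_cancel_left, abs_of_pos hAe]; linarith)).1
    have h3 := hm ha.le (show (0 : ℝ) ≤ a + A * e by linarith)
      (show a ≤ a + A * e by linarith)
    have h4 := hm (show (0 : ℝ) ≤ a + A * e by linarith) hx.le (show a + A * e ≤ x by linarith)
    rw [add_sub_cancel_left, abs_of_pos hAe, abs_of_nonneg (by linarith)] at h2
    exact mul_le_mul (by linarith) (by linarith) (by positivity) (by linarith)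
  · have hp : (0 : ℝ) ≤ a - A * e := by linarith
    have h2 := (h (a - A * e) (by rw [sub_sub_cancel_left, abs_neg, abs_of_pos hAe]; linarith)).1
    have h3 := hm hp ha.le (show a - A * e ≤ a by linarith)
    have h4 := hm hx.le hp (show x ≤ a - A * e by linarith)
    rw [sub_sub_cancel_left, abs_neg, abs_of_pos hAe, abs_of_nonpos (by linarith)] at h2
    rw [← neg_mul_neg (x - y)]
    exact mul_le_mul (by linarith) (by linarith) (by positivity) (by linarith)

theorem interfaceDensity_comm (γ a b : ℝ) : interfaceDensity γ a b = interfaceDensity γ b a := by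
  unfold interfaceDensity
  by_cases h : a = b
  · simp [h]
  · rw [if_neg h, if_neg (Ne.symm h), ← neg_div_neg_eq, neg_sub, neg_sub]

/-- By Cauchy's mean value theorem the interface density lies between the two cell densities. -/
theorem interfaceDensity_mem_uIcc {γ a b : ℝ} (hγ : 1 < γ) (ha : 0 < a) (hb : 0 < b) :
    interfaceDensity γ a b ∈ uIcc a b := by
  wlog hab : a ≤ b generalizing a b
  · rw [interfaceDensity_comm, uIcc_comm]
    exact this hb ha (le_of_not_ge hab)
  rcases hab.eq_or_lt with rfl | hlt
  · simp [interfaceDensity]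
  have hp : ∀ x ∈ Icc a b, 0 < x := fun x hx => ha.trans_le hx.1
  obtain ⟨c, hc, h⟩ := exists_ratio_hasDerivAt_eq_ratio_slope (fun x : ℝ => x ^ γ)
    (fun x => γ * x ^ (γ - 1)) hlt
    (fun x hx => (Real.hasDerivAt_rpow_const (Or.inl (hp x hx).ne')).continuousAt.continuousWithinAt)
    (fun x hx => Real.hasDerivAt_rpow_const (Or.inl (hp x (Ioo_subset_Icc_self hx)).ne'))
    (helmholtzDeriv γ) (fun x => γ * x ^ (γ - 2))
    (fun x hx => (hasDerivAt_helmholtzDeriv hγ (hp x hx)).continuousAt.continuousWithinAt)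
    (fun x hx => hasDerivAt_helmholtzDeriv hγ (hp x (Ioo_subset_Icc_self hx)))
  have hcp := hp c (Ioo_subset_Icc_self hc)
  have e : c ^ (γ - 1) = c * c ^ (γ - 2) := by
    rw [← Real.rpow_one_add' hcp.le (by linarith)]; ring_nf
  have hne : γ * c ^ (γ - 2) ≠ 0 :=
    mul_ne_zero (by linarith) (Real.rpow_pos_of_pos hcp _).ne'
  have hceq : c = interfaceDensity γ a b := by
    refine (interfaceDensity_iff hγ ha hb hlt.ne).2 (mul_right_cancel₀ hne ?_)
    rw [e] at h
    linear_combination h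
  rw [← hceq, uIcc_of_le hab]
  exact Ioo_subset_Icc_self hc

theorem interfaceDensity_pos {γ a b : ℝ} (hγ : 1 < γ) (ha : 0 < a) (hb : 0 < b) :
    0 < interfaceDensity γ a b :=
  (lt_min ha hb).trans_le (interfaceDensity_mem_uIcc hγ ha hb).1

theorem continuousAt_helmholtzDeriv {γ x : ℝ} (hγ : 1 < γ) (hx : 0 < x) :
    ContinuousAt (helmholtzDeriv γ) x :=
  (hasDerivAt_helmholtzDeriv hγ hx).continuousAt

/-- The interface density is continuous at pairs of positive densities, on the diagonal too. -/
theorem tendsto_interfaceDensity {ι : Type*} {l : Filter ι} {γ a b : ℝ} (hγ : 1 < γ) (ha : 0 < a)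
    (hb : 0 < b) {x y : ι → ℝ} (hx : Tendsto x l (𝓝 a)) (hy : Tendsto y l (𝓝 b)) :
    Tendsto (fun k => interfaceDensity γ (x k) (y k)) l (𝓝 (interfaceDensity γ a b)) := by
  by_cases hab : a = b
  · subst hab
    have hmem : ∀ᶠ k in l, interfaceDensity γ (x k) (y k) ∈ uIcc (x k) (y k) := by
      filter_upwards [hx.eventually (lt_mem_nhds ha), hy.eventually (lt_mem_nhds ha)] with k h1 h2
      exact interfaceDensity_mem_uIcc hγ h1 h2
    have hmin := hx.min hy
    have hmax := hx.max hy
    rw [min_self] at hmin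
    rw [max_self] at hmax
    rw [show interfaceDensity γ a a = a by simp [interfaceDensity]]
    exact tendsto_of_tendsto_of_tendsto_of_le_of_le' hmin hmax
      (hmem.mono fun k h => h.1) (hmem.mono fun k h => h.2)
  · have hne : ∀ᶠ k in l, x k ≠ y k := by
      filter_upwards [(hx.sub hy).eventually_ne (sub_ne_zero.2 hab)] with k hk
      exact sub_ne_zero.1 hk
    have hden : helmholtzDeriv γ a - helmholtzDeriv γ b ≠ 0 :=
      sub_ne_zero.2 fun h => hab ((helmholtzDeriv_strictMonoOn hγ).injOn ha.le hb.le h)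
    have ht : Tendsto (fun k => (x k ^ γ - y k ^ γ) /
        (helmholtzDeriv γ (x k) - helmholtzDeriv γ (y k))) l (𝓝 (interfaceDensity γ a b)) := by
      rw [interfaceDensity, if_neg hab]
      exact ((hx.rpow_const (Or.inl ha.ne')).sub (hy.rpow_const (Or.inl hb.ne'))).div
        (((continuousAt_helmholtzDeriv hγ ha).tendsto.comp hx).sub
          ((continuousAt_helmholtzDeriv hγ hb).tendsto.comp hy)) hden
    refine ht.congr' (hne.mono fun k hk => ?_)
    simp only [interfaceDensity, if_neg hk]

/-! ### Geometry of the grid -/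

namespace MACGrid

variable {d : ℕ} {M : Type*} {G : MACGrid d M}

theorem isCompact_closedCell (G : MACGrid d M) (K : M) : IsCompact (G.closedCell K) :=
  (G.cell K).isCompact_Icc

theorem measurableSet_closedCell (G : MACGrid d M) (K : M) : MeasurableSet (G.closedCell K) :=
  (G.isCompact_closedCell K).isClosed.measurableSet

theorem volume_real_pos_of_isOpen_subset {d : ℕ} {U A B : Set (Fin d → ℝ)} (hU : IsOpen U)
    (hne : U.Nonempty) (hUA : U ⊆ A) (hAB : A ⊆ B) (hB : IsCompact B) : 0 < volume.real A := by
  refine ENNReal.toReal_pos ?_ (measure_lt_top_of_subset hAB hB.measure_lt_top.ne).ne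
  exact ((hU.measure_pos volume hne).trans_le (measure_mono hUA)).ne'

theorem isOpen_cellIoo (G : MACGrid d M) (K : M) : IsOpen (BoxIntegral.Box.Ioo (G.cell K)) :=
  isOpen_set_pi finite_univ fun _ _ => isOpen_Ioo

theorem vol_pos (G : MACGrid d M) (K : M) : 0 < G.vol K := by
  refine volume_real_pos_of_isOpen_subset (G.isOpen_cellIoo K)
    ⟨fun j => ((G.cell K).lower j + (G.cell K).upper j) / 2, fun j _ => ?_⟩
    (G.cell K).Ioo_subset_Icc le_rfl (G.isCompact_closedCell K)
  have := (G.cell K).lower_lt_upper j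
  constructor <;> linarith

theorem Face.lowerHalf_subset (σ : G.Face) : σ.lowerHalf ⊆ G.closedCell σ.lower := fun _ h => h.1

theorem Face.upperHalf_subset (σ : G.Face) : σ.upperHalf ⊆ G.closedCell σ.upper := fun _ h => h.1

theorem Face.dualCell_subset (σ : G.Face) :
    σ.dualCell ⊆ G.closedCell σ.lower ∪ G.closedCell σ.upper :=
  union_subset_union σ.lowerHalf_subset σ.upperHalf_subset

theorem Face.volume_lowerHalf_pos (σ : G.Face) : 0 < volume.real σ.lowerHalf := by
  refine volume_real_pos_of_isOpen_subset
    (U := BoxIntegral.Box.Ioo (G.cell σ.lower) ∩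
      {x | ((G.cell σ.lower).lower σ.dir + (G.cell σ.lower).upper σ.dir) / 2 < x σ.dir})
    ((G.isOpen_cellIoo _).inter (isOpen_lt continuous_const (continuous_apply _)))
    ⟨fun j => ((G.cell σ.lower).lower j + 3 * (G.cell σ.lower).upper j) / 4, fun j _ => ?_, ?_⟩
    (fun x hx => ⟨(G.cell σ.lower).Ioo_subset_Icc hx.1, le_of_lt hx.2⟩)
    σ.lowerHalf_subset (G.isCompact_closedCell σ.lower)
  · have := (G.cell σ.lower).lower_lt_upper j
    constructor <;> dsimp only <;> linarith
  · have := (G.cell σ.lower).lower_lt_upper σ.dir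
    simp only [mem_ofPred_eq]
    linarith

theorem Face.vol_pos (σ : G.Face) : 0 < σ.vol :=
  σ.volume_lowerHalf_pos.trans_le (measureReal_mono subset_union_left
    (measure_lt_top_of_subset σ.dualCell_subset ((G.isCompact_closedCell σ.lower).union
      (G.isCompact_closedCell σ.upper)).measure_lt_top.ne).ne)

theorem dualAvg_pos {q : M → ℝ} (hq : ∀ K, 0 < q K) (σ : G.Face) : 0 < dualAvg q σ :=
  div_pos (add_pos_of_pos_of_nonneg (mul_pos σ.volume_lowerHalf_pos (hq _))
    (mul_nonneg measureReal_nonneg (hq _).le)) σ.vol_pos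

theorem cellIoo_subset_domain (G : MACGrid d M) (K : M) :
    BoxIntegral.Box.Ioo (G.cell K) ⊆ G.domain :=
  interior_maximal ((G.cell K).Ioo_subset_Icc.trans (subset_iUnion G.closedCell K))
    (G.isOpen_cellIoo K)

theorem closedCell_subset_closure_domain (G : MACGrid d M) (K : M) :
    G.closedCell K ⊆ closure G.domain := by
  refine Subset.trans (Eq.subset ?_) (closure_mono (G.cellIoo_subset_domain K))
  rw [closedCell, BoxIntegral.Box.Icc_eq_pi]
  change _ = closure (Set.pi univ fun i => Ioo ((G.cell K).lower i) ((G.cell K).upper i))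
  rw [closure_pi_set]
  simp only [closure_Ioo ((G.cell K).lower_lt_upper _).ne]

theorem closedCell_ae_le_domain (G : MACGrid d M) (K : M) :
    G.closedCell K ≤ᵐ[volume] G.domain :=
  (BoxIntegral.Box.Ioo_ae_eq_Icc (G.cell K)).symm.le.trans
    (LE.le.eventuallyLE (G.cellIoo_subset_domain K))

theorem Face.dualCell_ae_le_domain (σ : G.Face) : σ.dualCell ≤ᵐ[volume] G.domain := by
  refine (LE.le.eventuallyLE σ.dualCell_subset).trans ?_
  filter_upwards [G.closedCell_ae_le_domain σ.lower, G.closedCell_ae_le_domain σ.upper]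
    with x h1 h2 h
  exact h.elim h1 h2

theorem volume_domain_lt_top [Fintype M] (G : MACGrid d M) : volume G.domain < ⊤ :=
  measure_lt_top_of_subset interior_subset
    (isCompact_iUnion G.isCompact_closedCell).measure_lt_top.ne

/-! ### Averages of the data -/

theorem continuousOn_hydroDensity {γ C : ℝ} (hγ : 1 < γ) {φ : (Fin d → ℝ) → ℝ}
    {A : Set (Fin d → ℝ)} (hφ : ContinuousOn φ A) (hC : ∀ x ∈ A, φ x < C) :
    ContinuousOn (hydroDensity γ C φ) A := by
  unfold hydroDensity
  refine ((continuousOn_const.sub hφ).const_mul _).rpow_const fun x hx => Or.inl ?_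
  exact (mul_pos (div_pos (by linarith) (by linarith)) (sub_pos.2 (hC x hx))).ne'

theorem hydroDensity_pos {γ C : ℝ} (hγ : 1 < γ) {φ : (Fin d → ℝ) → ℝ} {x : Fin d → ℝ}
    (hC : φ x < C) : 0 < hydroDensity γ C φ x :=
  Real.rpow_pos_of_pos (mul_pos (div_pos (by linarith) (by linarith)) (sub_pos.2 hC)) _

theorem integrableOn_hydroDensity (G : MACGrid d M) {γ C : ℝ} (hγ : 1 < γ) {φ : (Fin d → ℝ) → ℝ}
    (hφ : ContinuousOn φ (closure G.domain)) (hC : ∀ x ∈ closure G.domain, φ x < C) (K : M) :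
    IntegrableOn (hydroDensity γ C φ) (G.closedCell K) :=
  ((continuousOn_hydroDensity hγ hφ hC).mono
    (G.closedCell_subset_closure_domain K)).integrableOn_compact (G.isCompact_closedCell K)

theorem hydro_pos (G : MACGrid d M) {γ C : ℝ} (hγ : 1 < γ) {φ : (Fin d → ℝ) → ℝ}
    (hφ : ContinuousOn φ (closure G.domain)) (hC : ∀ x ∈ closure G.domain, φ x < C) (K : M) :
    0 < G.hydro γ C φ K := by
  rw [hydro, cellAvg, setAverage_eq, smul_eq_mul]
  refine mul_pos (inv_pos.2 (G.vol_pos K)) ?_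
  have hpos : ∀ x ∈ G.closedCell K, 0 < hydroDensity γ C φ x := fun x hx =>
    hydroDensity_pos hγ (hC x (G.closedCell_subset_closure_domain K hx))
  rw [setIntegral_pos_iff_support_of_nonneg_ae
    (ae_restrict_of_forall_mem (G.measurableSet_closedCell K) fun x hx => (hpos x hx).le)
    (G.integrableOn_hydroDensity hγ hφ hC K),
    inter_eq_right.2 (show _ ⊆ Function.support _ from fun x hx => (hpos x hx).ne')]
  exact (ENNReal.toReal_pos_iff.1 (G.vol_pos K)).1

/-- The average over a cell of an essentially bounded perturbation. -/
theorem abs_cellAvg_sub_le (G : MACGrid d M) {K : M} {f g : (Fin d → ℝ) → ℝ} {B : ℝ}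
    (hf : IntegrableOn f (G.closedCell K)) (hg : IntegrableOn g (G.closedCell K))
    (h : ∀ᵐ x ∂volume.restrict G.domain, |f x - g x| ≤ B) :
    |G.cellAvg f K - G.cellAvg g K| ≤ B := by
  have h' : ∀ᵐ x ∂volume.restrict (G.closedCell K), ‖f x - g x‖ ≤ B :=
    ae_mono (Measure.restrict_mono' (G.closedCell_ae_le_domain K) le_rfl) h
  have h2 := norm_setIntegral_le_of_norm_le_const_ae (G.isCompact_closedCell K).measure_lt_top h'
  rw [integral_sub hf hg, Real.norm_eq_abs] at h2
  simp only [cellAvg, setAverage_eq, smul_eq_mul]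
  change |(G.vol K)⁻¹ * _ - (G.vol K)⁻¹ * _| ≤ B
  rw [← mul_sub, abs_mul, abs_of_pos (inv_pos.2 (G.vol_pos K)), inv_mul_le_iff₀ (G.vol_pos K),
    mul_comm]
  exact h2

/-- Convergence in `L²(Ω)` implies convergence of the averages over the dual cells. -/
theorem tendsto_faceAvg [Fintype M] {ι : Type*} {l : Filter ι}
    {v : ι → (Fin d → ℝ) → (Fin d → ℝ)} {V : (Fin d → ℝ) → (Fin d → ℝ)}
    (hv : ∀ k, MemLp (v k) 2 (volume.restrict G.domain))
    (hV : MemLp V 2 (volume.restrict G.domain))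
    (h : Tendsto (fun k => eLpNorm (v k - V) 2 (volume.restrict G.domain)) l (𝓝 0)) :
    Tendsto (fun k => G.faceAvg (v k)) l (𝓝 (G.faceAvg V)) := by
  rw [tendsto_pi_nhds]
  intro σ
  have hle : volume.restrict σ.dualCell ≤ volume.restrict G.domain :=
    Measure.restrict_mono' σ.dualCell_ae_le_domain le_rfl
  have : IsFiniteMeasure (volume.restrict σ.dualCell) :=
    ⟨by rw [Measure.restrict_apply_univ]
        exact measure_lt_top_of_subset σ.dualCell_subset ((G.isCompact_closedCell σ.lower).union
          (G.isCompact_closedCell σ.upper)).measure_lt_top.ne⟩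
  have hint : ∀ w : (Fin d → ℝ) → (Fin d → ℝ), MemLp w 2 (volume.restrict G.domain) →
      Integrable (fun x => w x σ.dir) (volume.restrict σ.dualCell) := fun w hw =>
    ((ContinuousLinearMap.proj (R := ℝ) (φ := fun _ : Fin d => ℝ) σ.dir).comp_memLp'
      (hw.mono_measure hle)).integrable (by norm_num)
  have hL1 : Tendsto (fun k => eLpNorm ((fun x => v k x σ.dir) - fun x => V x σ.dir) 1
      (volume.restrict σ.dualCell)) l (𝓝 0) := by
    have hc : volume.restrict σ.dualCell univ ^ (1 / (1 : ℝ≥0∞).toReal - 1 / (2 : ℝ≥0∞).toReal)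
        ≠ ⊤ := ENNReal.rpow_ne_top_of_nonneg (by norm_num) (measure_ne_top _ _)
    have h0 := ENNReal.Tendsto.mul_const h (Or.inr hc)
    rw [zero_mul] at h0
    refine tendsto_of_tendsto_of_tendsto_of_le_of_le tendsto_const_nhds h0 (fun _ => zero_le)
      fun k => ?_
    refine (eLpNorm_le_eLpNorm_mul_rpow_measure_univ (by norm_num)
      ((hint _ (hv k)).sub (hint _ hV)).aestronglyMeasurable).trans (mul_le_mul_left ?_ _)
    exact (eLpNorm_mono fun x => norm_le_pi_norm ((v k - V) x) σ.dir).trans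
      (eLpNorm_mono_measure _ hle)
  simp only [faceAvg, setAverage_eq]
  exact (tendsto_integral_of_L1' _ (hint _ hV).aestronglyMeasurable
    (Eventually.of_forall fun k => hint _ (hv k)) hL1).const_smul _

/-! ### Discrete differential calculus -/

/-- Discrete integration by parts: the divergence is minus the adjoint of the gradient, the fluxes
through the external faces being zero. -/
theorem sum_vol_mul_divM [Fintype M] (γ : ℝ) (q : M → ℝ) (w : G.Face → ℝ) (θ : M → ℝ) :
    ∑ K, G.vol K * θ K * divM γ q w K =
      -∑ σ : G.Face, σ.vol * faceDensity γ q σ * w σ * grad θ σ := by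
  classical
  have h1 : ∀ K, G.vol K * θ K * divM γ q w K = ∑ σ : G.Face, σ.area * faceDensity γ q σ * w σ *
      ((if σ.lower = K then θ K else 0) - if σ.upper = K then θ K else 0) := by
    intro K
    have hne := (G.vol_pos K).ne'
    calc G.vol K * θ K * divM γ q w K
        = θ K * ∑ j : Fin d, ∑ s : Bool, massFlux γ q w K j s := by
          rw [divM]; field_simp
      _ = θ K * ∑ σ : G.Face, ∑ j : Fin d, ∑ s : Bool, if IsFaceOf σ K j s then
            σ.area * faceDensity γ q σ * (sideSign s * w σ) else 0 := by
          simp only [massFlux]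
          rw [Finset.sum_comm]
          congr 1
          rw [Finset.sum_comm]
          refine (Finset.sum_congr rfl fun j _ => Finset.sum_comm).trans ?_
          rw [Finset.sum_comm]
      _ = _ := by
          rw [Finset.mul_sum]
          refine Finset.sum_congr rfl fun σ _ => ?_
          by_cases hl : σ.lower = K <;> by_cases hu : σ.upper = K <;>
            simp [IsFaceOf, sideSign, hl, hu, Finset.sum_add_distrib] <;> ring
  simp_rw [h1]
  rw [Finset.sum_comm, ← Finset.sum_neg_distrib]
  refine Finset.sum_congr rfl fun σ _ => ?_
  have hne := σ.vol_pos.ne'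
  rw [← Finset.mul_sum, Finset.sum_sub_distrib]
  simp only [Finset.sum_ite_eq, Finset.mem_univ, if_true, grad]
  field_simp
  ring

theorem faceDensity_pos {γ : ℝ} (hγ : 1 < γ) {q : M → ℝ} (hq : ∀ K, 0 < q K) (σ : G.Face) :
    0 < faceDensity γ q σ :=
  interfaceDensity_pos hγ (hq _) (hq _)

/-- The relation defining the interface density turns the pressure gradient into `q_σ` times the
gradient of `h_γ'(q)`. -/
theorem grad_rpow {γ : ℝ} (hγ : 1 < γ) {q : M → ℝ} (hq : ∀ K, 0 < q K) (σ : G.Face) :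
    grad (fun K => q K ^ γ) σ = faceDensity γ q σ * grad (fun K => helmholtzDeriv γ (q K)) σ := by
  unfold grad faceDensity
  by_cases h : q σ.lower = q σ.upper
  · simp [h]
  · have := (interfaceDensity_iff hγ (hq σ.lower) (hq σ.upper) h).1 rfl
    linear_combination (-(σ.area / σ.vol)) * this

/-- The discrete gradient as a linear map. -/
noncomputable def gradLin (G : MACGrid d M) : (M → ℝ) →ₗ[ℝ] (G.Face → ℝ) where
  toFun := grad
  map_add' q r := by funext σ; simp only [grad, Pi.add_apply]; ring
  map_smul' c q := by
    funext σ; simp only [grad, Pi.smul_apply, smul_eq_mul, RingHom.id_apply]; ring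

theorem gradLin_apply (q : M → ℝ) (σ : G.Face) : G.gradLin q σ = grad q σ := rfl

/-- The chemical potential `(h_γ'(ρ) - h_γ'(ρ̃)) / ε²` relative to the hydrostatic state. -/
noncomputable def scaledPotential (γ ε : ℝ) (ρt ρ : M → ℝ) (K : M) : ℝ :=
  1 / ε ^ 2 * (helmholtzDeriv γ (ρ K) - helmholtzDeriv γ (ρt K))

/-- The discretisation is well balanced: pressure gradient and gravity combine into the gradient of
the scaled potential. -/
theorem grad_pressure_add {γ ε C : ℝ} (hγ : 1 < γ) {φ : (Fin d → ℝ) → ℝ} {ρ : M → ℝ}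
    (hρ : ∀ K, 0 < ρ K) (σ : G.Face) :
    1 / ε ^ 2 * (grad (fun K => ρ K ^ γ) σ + faceDensity γ ρ σ * grad (G.potential γ C φ) σ) =
      faceDensity γ ρ σ * grad (scaledPotential γ ε (G.hydro γ C φ) ρ) σ := by
  rw [grad_rpow hγ hρ]
  simp only [grad, potential, scaledPotential]
  ring

theorem correction_eq_anelasticCorrection {γ η δt ε C : ℝ} (hγ : 1 < γ) {φ : (Fin d → ℝ) → ℝ}
    {ρ : M → ℝ} (hρ : ∀ K, 0 < ρ K) :
    correction (G := G) γ η δt ε (G.potential γ C φ) ρ =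
      anelasticCorrection γ η δt ρ (scaledPotential γ ε (G.hydro γ C φ) ρ) := by
  funext σ
  rw [correction, anelasticCorrection, ← grad_pressure_add hγ hρ]
  ring

/-! ### Continuity of the discrete operators -/

section Limits

variable {ι : Type*} {l : Filter ι} {γ : ℝ} {q : ι → M → ℝ} {q0 : M → ℝ}
  {w v : ι → G.Face → ℝ} {w0 v0 : G.Face → ℝ}

theorem tendsto_faceDensity (hγ : 1 < γ) (hq0 : ∀ K, 0 < q0 K) (hq : Tendsto q l (𝓝 q0))
    (σ : G.Face) :
    Tendsto (fun k => faceDensity γ (q k) σ) l (𝓝 (faceDensity γ q0 σ)) :=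
  tendsto_interfaceDensity hγ (hq0 _) (hq0 _) (hq.apply_nhds _) (hq.apply_nhds _)

theorem tendsto_dualAvg (hq : Tendsto q l (𝓝 q0)) (σ : G.Face) :
    Tendsto (fun k => dualAvg (q k) σ) l (𝓝 (dualAvg q0 σ)) :=
  (((hq.apply_nhds _).const_mul _).add ((hq.apply_nhds _).const_mul _)).div_const _

variable [Fintype M]

theorem tendsto_massFlux (hγ : 1 < γ) (hq0 : ∀ K, 0 < q0 K) (hq : Tendsto q l (𝓝 q0))
    (hw : Tendsto w l (𝓝 w0)) (K : M) (j : Fin d) (s : Bool) :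
    Tendsto (fun k => massFlux γ (q k) (w k) K j s) l (𝓝 (massFlux γ q0 w0 K j s)) := by
  unfold massFlux
  refine tendsto_finsetSum _ fun σ _ => ?_
  split_ifs
  · exact ((tendsto_faceDensity hγ hq0 hq σ).const_mul _).mul ((hw.apply_nhds σ).const_mul _)
  · exact tendsto_const_nhds

theorem tendsto_divM (hγ : 1 < γ) (hq0 : ∀ K, 0 < q0 K) (hq : Tendsto q l (𝓝 q0))
    (hw : Tendsto w l (𝓝 w0)) (K : M) :
    Tendsto (fun k => divM γ (q k) (w k) K) l (𝓝 (divM γ q0 w0 K)) :=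
  (tendsto_finsetSum _ fun j _ => tendsto_finsetSum _ fun s _ =>
    tendsto_massFlux hγ hq0 hq hw K j s).const_mul _

theorem tendsto_neighbourVal (hv : Tendsto v l (𝓝 v0)) (σ : G.Face) (j : Fin d) (s : Bool) :
    Tendsto (fun k => neighbourVal (v k) σ j s) l (𝓝 (neighbourVal v0 σ j s)) := by
  unfold neighbourVal
  refine tendsto_finsetSum _ fun σ' _ => ?_
  split_ifs
  · exact hv.apply_nhds σ'
  · exact tendsto_const_nhds

/-- The upwind flux is continuous although the upwind value is not: the latter jumps only where
the mass flux vanishes. -/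
theorem tendsto_upwindFlux (hγ : 1 < γ) (hq0 : ∀ K, 0 < q0 K) (hq : Tendsto q l (𝓝 q0))
    (hw : Tendsto w l (𝓝 w0)) (hv : Tendsto v l (𝓝 v0)) (σ : G.Face) :
    Tendsto (fun k => upwindFlux γ (q k) (w k) (v k) σ) l (𝓝 (upwindFlux γ q0 w0 v0 σ)) := by
  have hup : ∀ F a b : ℝ, (F * if 0 ≤ F then a else b) = max F 0 * a + min F 0 * b := by
    intro F a b
    split_ifs with h
    · simp [h]
    · simp [(not_le.1 h).le]
  unfold upwindFlux
  simp only [hup]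
  refine tendsto_finsetSum _ fun j _ => tendsto_finsetSum _ fun s _ => ?_
  have hF : Tendsto (fun k => dualFlux γ (q k) (w k) σ j s) l (𝓝 (dualFlux γ q0 w0 σ j s)) :=
    ((tendsto_massFlux hγ hq0 hq hw _ j s).add (tendsto_massFlux hγ hq0 hq hw _ j s)).div_const _
  exact ((hF.max tendsto_const_nhds).mul (hv.apply_nhds σ)).add
    ((hF.min tendsto_const_nhds).mul (tendsto_neighbourVal hv σ j s))

end Limits

end MACGrid

/-! ### Compactness and boundedness -/

/-- A family that stays in a compact set and whose limit points all have a property satisfied by at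
most one point converges, and its limit has the property. -/
theorem exists_tendsto_of_isCompact_of_unique {ι X : Type*} [TopologicalSpace X] {l : Filter ι}
    [l.NeBot] {f : ι → X} {S : Set X} {p : X → Prop} (hS : IsCompact S)
    (hf : ∀ᶠ k in l, f k ∈ S)
    (hp : ∀ (m : Filter ι) [m.NeBot], m ≤ l → ∀ x, Tendsto f m (𝓝 x) → p x)
    (huniq : ∀ x y, p x → p y → x = y) :
    ∃ x, p x ∧ Tendsto f l (𝓝 x) := by
  have key : ∀ m : Ultrafilter ι, ↑m ≤ l → ∃ x, p x ∧ Tendsto f m (𝓝 x) := by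
    intro m hm
    obtain ⟨x, -, hx⟩ := hS.ultrafilter_le_nhds (m.map f)
      (le_principal_iff.2 (Ultrafilter.mem_map.2 (hm hf)))
    exact ⟨x, hp m hm x hx, hx⟩
  obtain ⟨x, hpx, -⟩ := key (Ultrafilter.of l) (Ultrafilter.of_le l)
  refine ⟨x, hpx, tendsto_iff_ultrafilter f l _ |>.2 fun m hm => ?_⟩
  obtain ⟨y, hpy, hy⟩ := key m hm
  rwa [huniq x y hpx hpy]

/-- If the terms of a finite sum are bounded below and the sum is bounded above, then so are its
terms. -/
theorem exists_eventually_le_of_sum_le {ι κ : Type*} [Fintype κ] {l : Filter ι} {a : κ → ι → ℝ}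
    (hlow : ∀ i, ∃ C, ∀ᶠ k in l, -C ≤ a i k) (hsum : ∃ C, ∀ᶠ k in l, ∑ i, a i k ≤ C) (i : κ) :
    ∃ C, ∀ᶠ k in l, a i k ≤ C := by
  choose C hC using hlow
  obtain ⟨D, hD⟩ := hsum
  refine ⟨D + ∑ j, C j - C i, ?_⟩
  filter_upwards [eventually_all.2 hC, hD] with k h1 h2
  have h3 := Finset.single_le_sum (f := fun j => a j k + C j)
    (fun j _ => by have := h1 j; linarith) (Finset.mem_univ i)
  rw [Finset.sum_add_distrib] at h3
  linarith

theorem exists_eventually_le_of_tendsto {ι : Type*} {l : Filter ι} {f : ι → ℝ} {a : ℝ}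
    (h : Tendsto f l (𝓝 a)) : ∃ C, ∀ᶠ k in l, f k ≤ C :=
  ⟨a + 1, (h.eventually (gt_mem_nhds (lt_add_one a))).mono fun _ hk => le_of_lt hk⟩

theorem tendsto_of_eventually_abs_sub_le_mul {ι : Type*} {l : Filter ι} {f ε : ι → ℝ} {a B : ℝ}
    (hε0 : Tendsto ε l (𝓝 0)) (h : ∀ᶠ k in l, |f k - a| ≤ B * ε k) : Tendsto f l (𝓝 a) := by
  rw [tendsto_iff_dist_tendsto_zero]
  have h0 := hε0.const_mul B
  rw [mul_zero] at h0
  exact tendsto_of_tendsto_of_tendsto_of_le_of_le' tendsto_const_nhds h0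
    (Eventually.of_forall fun _ => dist_nonneg) h

namespace MACGrid

variable {d : ℕ} {M : Type*} [Fintype M] {G : MACGrid d M}

/-! ### The anelastic projection -/

/-- The discrete elliptic problem for the anelastic pressure determines the pressure gradient: the
difference of two problems is tested with the difference of their solutions. Positivity of `η` is
assumed only if there are faces, since the stability condition is void otherwise. -/
theorem grad_eq_of_divM_eq_zero {γ η δt : ℝ} (hγ : 1 < γ) (hδt : 0 < δt)
    (hη : ∀ _ : G.Face, 0 < η) {q : M → ℝ} (hq : ∀ K, 0 < q K) {U : G.Face → ℝ} {π₁ π₂ : M → ℝ}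
    (h₁ : ∀ K, divM γ q (U - anelasticCorrection γ η δt q π₁) K = 0)
    (h₂ : ∀ K, divM γ q (U - anelasticCorrection γ η δt q π₂) K = 0) :
    G.gradLin π₁ = G.gradLin π₂ := by
  have e₁ := sum_vol_mul_divM γ q (U - anelasticCorrection γ η δt q π₁) (π₁ - π₂)
  have e₂ := sum_vol_mul_divM γ q (U - anelasticCorrection γ η δt q π₂) (π₁ - π₂)
  simp only [h₁, h₂, mul_zero, Finset.sum_const_zero] at e₁ e₂
  have hg : ∀ σ : G.Face, grad (π₁ - π₂) σ = grad π₁ σ - grad π₂ σ := fun σ => by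
    simp only [grad, Pi.sub_apply]; ring
  have e : ∑ σ : G.Face, σ.vol * (η * δt) *
      (faceDensity γ q σ * (grad π₁ σ - grad π₂ σ)) ^ 2 = 0 := by
    rw [← neg_eq_zero, ← Finset.sum_neg_distrib, ← sub_eq_zero.2 (neg_injective (e₁.symm.trans e₂)),
      ← Finset.sum_sub_distrib]
    refine Finset.sum_congr rfl fun σ _ => ?_
    rw [hg]
    simp only [Pi.sub_apply, anelasticCorrection]
    ring
  rw [Finset.sum_eq_zero_iff_of_nonneg fun σ _ => mul_nonneg
    (mul_nonneg σ.vol_pos.le (mul_pos (hη σ) hδt).le) (sq_nonneg _)] at e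
  funext σ
  have h := e σ (Finset.mem_univ σ)
  have hne : σ.vol * (η * δt) ≠ 0 := (mul_pos σ.vol_pos (mul_pos (hη σ) hδt)).ne'
  have h' := pow_eq_zero_iff two_ne_zero |>.1 ((mul_eq_zero.1 h).resolve_left hne)
  exact sub_eq_zero.1 ((mul_eq_zero.1 h').resolve_left (faceDensity_pos hγ hq σ).ne')

/-! ### One time step -/

/-- The energy estimate: the mass balance tested with the scaled potential `P`. The velocity
correction turns into a dissipation of the gradient of `P`, which absorbs the work of the
explicit velocity. -/
theorem energy_estimate {γ η δt : ℝ} (hδt : 0 < δt)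
    (hη : ∀ _ : G.Face, 0 < η) {ρ' ρ P : M → ℝ} {u' : G.Face → ℝ}
    (hmass : ∀ K, 1 / δt * (ρ K - ρ' K) +
      divM γ ρ (u' - anelasticCorrection γ η δt ρ P) K = 0) :
    ∑ K, G.vol K / δt * ((ρ K - ρ' K) * P K) +
      ∑ σ : G.Face, η * δt / 2 * σ.vol * (faceDensity γ ρ σ * grad P σ) ^ 2 ≤
    ∑ σ : G.Face, σ.vol * u' σ ^ 2 / (2 * η * δt) := by
  have h1 : ∑ K, G.vol K / δt * ((ρ K - ρ' K) * P K) =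
      -∑ K, G.vol K * P K * divM γ ρ (u' - anelasticCorrection γ η δt ρ P) K := by
    rw [← Finset.sum_neg_distrib]
    refine Finset.sum_congr rfl fun K _ => ?_
    linear_combination G.vol K * P K * hmass K
  rw [h1, sum_vol_mul_divM, neg_neg, ← Finset.sum_add_distrib]
  refine Finset.sum_le_sum fun σ _ => ?_
  have hη' := hη σ
  have hV := σ.vol_pos
  simp only [Pi.sub_apply, anelasticCorrection]
  set y := faceDensity γ ρ σ * grad P σ
  -- Young's inequality
  have h2 : σ.vol * u' σ ^ 2 / (2 * η * δt) - (σ.vol * u' σ * y - η * δt / 2 * σ.vol * y ^ 2) =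
      σ.vol / (2 * η * δt) * (u' σ - η * δt * y) ^ 2 := by
    field_simp; ring
  have h3 : 0 ≤ σ.vol / (2 * η * δt) * (u' σ - η * δt * y) ^ 2 := by positivity
  have h4 : σ.vol * faceDensity γ ρ σ * (u' σ - η * δt * y) * grad P σ =
      σ.vol * u' σ * y - η * δt * σ.vol * y ^ 2 := by
    simp only [y]; ring
  linarith

variable {ι : Type*} {l : Filter ι}

/-- The uniform estimates of one time step: the density stays at distance `O(ε)` from the
hydrostatic one, and the gradient of the scaled potential stays bounded. -/
theorem step_bounds {γ η δt : ℝ} (hγ : 1 < γ) (hδt : 0 < δt)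
    (hη : ∀ _ : G.Face, 0 < η) {ε : ι → ℝ} (hε : ∀ k, 0 < ε k) (hε0 : Tendsto ε l (𝓝 0))
    {q : M → ℝ} (hq : ∀ K, 0 < q K) {ρ' ρ : ι → M → ℝ} {u' : ι → G.Face → ℝ} {U' : G.Face → ℝ}
    (hρ : ∀ k K, 0 < ρ k K)
    (hmass : ∀ k K, 1 / δt * (ρ k K - ρ' k K) + divM γ (ρ k)
      (u' k - anelasticCorrection γ η δt (ρ k) (scaledPotential γ (ε k) q (ρ k))) K = 0)
    (hρ' : ∀ K, ∃ B, ∀ᶠ k in l, |ρ' k K - q K| ≤ B * ε k) (hu' : Tendsto u' l (𝓝 U')) :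
    (∀ K, ∃ B, ∀ᶠ k in l, |ρ k K - q K| ≤ B * ε k) ∧
    ∀ σ : G.Face, ∃ C, ∀ᶠ k in l,
      |faceDensity γ (ρ k) σ * grad (scaledPotential γ (ε k) q (ρ k)) σ| ≤ C := by
  set P := fun k => scaledPotential γ (ε k) q (ρ k) with hP
  set a : M ⊕ G.Face → ι → ℝ := fun i k => Sum.elim
    (fun K => G.vol K / δt * ((ρ k K - ρ' k K) * P k K))
    (fun σ : G.Face => η * δt / 2 * σ.vol * (faceDensity γ (ρ k) σ * grad (P k) σ) ^ 2) i
    with ha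
  have hlow : ∀ i, ∃ C, ∀ᶠ k in l, -C ≤ a i k := by
    rintro (K | σ)
    · obtain ⟨B, hB⟩ := hρ' K
      obtain ⟨C, δ, hC, hδ, h⟩ := exists_le_sub_mul_helmholtzDeriv_sub hγ (hq K)
      refine ⟨G.vol K / δt * (C * B ^ 2), ?_⟩
      have hlim := (tendsto_of_eventually_abs_sub_le_mul hε0 hB).eventually
        (Metric.closedBall_mem_nhds _ hδ)
      filter_upwards [hB, hlim] with k h1 h2
      have hεk := hε k
      have h3 := h (ρ k K) (ρ' k K) (hρ k K) h2
      have h4 : (ρ' k K - q K) ^ 2 ≤ (B * ε k) ^ 2 := by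
        rw [← sq_abs]; gcongr
      have h5 : -(C * B ^ 2) ≤ (ρ k K - ρ' k K) * P k K := by
        have h6 : -(C * (B * ε k) ^ 2) ≤ (ρ k K - ρ' k K) *
            (helmholtzDeriv γ (ρ k K) - helmholtzDeriv γ (q K)) := by
          refine le_trans (neg_le_neg ?_) h3
          gcongr
        have h7 := mul_le_mul_of_nonneg_left h6 (show 0 ≤ 1 / ε k ^ 2 by positivity)
        simp only [hP, scaledPotential]
        calc -(C * B ^ 2) = 1 / ε k ^ 2 * -(C * (B * ε k) ^ 2) := by field_simp
          _ ≤ _ := h7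
          _ = _ := by ring
      have := mul_le_mul_of_nonneg_left h5 (div_pos (G.vol_pos K) hδt).le
      simp only [ha, Sum.elim_inl]
      linarith
    · refine ⟨0, Eventually.of_forall fun k => ?_⟩
      have := hη σ
      have := σ.vol_pos
      simp only [ha, Sum.elim_inr, neg_zero]
      positivity
  have hsum : ∃ C, ∀ᶠ k in l, ∑ i, a i k ≤ C := by
    have ht : Tendsto (fun k => ∑ σ : G.Face, σ.vol * u' k σ ^ 2 / (2 * η * δt)) l
        (𝓝 (∑ σ : G.Face, σ.vol * U' σ ^ 2 / (2 * η * δt))) :=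
      tendsto_finsetSum _ fun σ _ => (((hu'.apply_nhds σ).pow 2).const_mul _).div_const _
    obtain ⟨C, hC⟩ := exists_eventually_le_of_tendsto ht
    refine ⟨C, hC.mono fun k hk => le_trans ?_ hk⟩
    rw [Fintype.sum_sum_type]
    exact energy_estimate hδt hη (hmass k)
  have hup := exists_eventually_le_of_sum_le hlow hsum
  refine ⟨fun K => ?_, fun σ => ?_⟩
  · obtain ⟨B, hB⟩ := hρ' K
    obtain ⟨D, hD⟩ := hup (Sum.inl K)
    simp only [ha, Sum.elim_inl] at hD
    have hvol := div_pos (G.vol_pos K) hδt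
    obtain ⟨A, δ, hδ, h⟩ := exists_abs_sub_le_of_sub_mul_le (B := |B|)
      (D := |D| / (G.vol K / δt)) hγ (hq K) (abs_nonneg B) (by positivity)
    refine ⟨A, ?_⟩
    filter_upwards [hB, hD, hε0.eventually (ge_mem_nhds hδ)] with k h1 h2 h3
    have hεk := hε k
    refine h (ρ k K) (ρ' k K) (ε k) (hρ k K) hεk h3
      (h1.trans (by gcongr; exact le_abs_self B)) ?_
    have h4 : (ρ k K - ρ' k K) * P k K ≤ |D| / (G.vol K / δt) := by
      rw [le_div_iff₀' hvol]; exact h2.trans (le_abs_self D)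
    calc (ρ k K - ρ' k K) * (helmholtzDeriv γ (ρ k K) - helmholtzDeriv γ (q K))
        = ((ρ k K - ρ' k K) * P k K) * ε k ^ 2 := by
          simp only [hP, scaledPotential]; field_simp
      _ ≤ _ := by gcongr
  · obtain ⟨D, hD⟩ := hup (Sum.inr σ)
    have hc : 0 < η * δt / 2 * σ.vol := mul_pos (half_pos (mul_pos (hη σ) hδt)) σ.vol_pos
    refine ⟨√(D / (η * δt / 2 * σ.vol)), hD.mono fun k hk => Real.abs_le_sqrt ?_⟩
    rw [le_div_iff₀' hc]
    exact hk

/-- One time step of the limit `ε → 0`: convergence at the old time level carries over to the new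
one, and the limit satisfies the equations of the anelastic scheme. -/
theorem step_limit [l.NeBot] {γ η δt : ℝ} (hγ : 1 < γ) (hδt : 0 < δt)
    (hη : ∀ _ : G.Face, 0 < η) {ε : ι → ℝ} (hε : ∀ k, 0 < ε k) (hε0 : Tendsto ε l (𝓝 0))
    {q : M → ℝ} (hq : ∀ K, 0 < q K) {ρ' ρ : ι → M → ℝ} {u' u : ι → G.Face → ℝ} {U' : G.Face → ℝ}
    (hρ : ∀ k K, 0 < ρ k K)
    (hmass : ∀ k K, 1 / δt * (ρ k K - ρ' k K) + divM γ (ρ k)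
      (u' k - anelasticCorrection γ η δt (ρ k) (scaledPotential γ (ε k) q (ρ k))) K = 0)
    (hmom : ∀ k, ∀ σ : G.Face,
      1 / δt * (dualAvg (ρ k) σ * u k σ - dualAvg (ρ' k) σ * u' k σ) +
        1 / σ.vol * upwindFlux γ (ρ k)
          (u' k - anelasticCorrection γ η δt (ρ k) (scaledPotential γ (ε k) q (ρ k))) (u' k) σ +
        faceDensity γ (ρ k) σ * grad (scaledPotential γ (ε k) q (ρ k)) σ = 0)
    (hρ' : ∀ K, ∃ B, ∀ᶠ k in l, |ρ' k K - q K| ≤ B * ε k) (hu' : Tendsto u' l (𝓝 U')) :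
    (∀ K, ∃ B, ∀ᶠ k in l, |ρ k K - q K| ≤ B * ε k) ∧
    ∃ (U : G.Face → ℝ) (π : M → ℝ), Tendsto u l (𝓝 U) ∧
      (∀ K, divM γ q (U' - anelasticCorrection γ η δt q π) K = 0) ∧
      ∀ σ : G.Face, 1 / δt * (dualAvg q σ * (U σ - U' σ)) +
        1 / σ.vol * upwindFlux γ q (U' - anelasticCorrection γ η δt q π) U' σ +
        faceDensity γ q σ * grad π σ = 0 := by
  obtain ⟨hb, hgb⟩ := step_bounds hγ hδt hη hε hε0 hq hρ hmass hρ' hu'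
  refine ⟨hb, ?_⟩
  have hlim : Tendsto ρ l (𝓝 q) := tendsto_pi_nhds.2 fun K =>
    tendsto_of_eventually_abs_sub_le_mul hε0 (hb K).choose_spec
  have hlim' : Tendsto ρ' l (𝓝 q) := tendsto_pi_nhds.2 fun K =>
    tendsto_of_eventually_abs_sub_le_mul hε0 (hρ' K).choose_spec
  set P := fun k => scaledPotential γ (ε k) q (ρ k)
  have hfd := fun σ : G.Face => tendsto_faceDensity hγ hq hlim σ
  -- convergence of the corrected velocity, given that of the gradient of the potential
  have hcorr : ∀ m ≤ l, ∀ π : M → ℝ, Tendsto (fun k => G.gradLin (P k)) m (𝓝 (G.gradLin π)) →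
      Tendsto (fun k => u' k - anelasticCorrection γ η δt (ρ k) (P k)) m
        (𝓝 (U' - anelasticCorrection γ η δt q π)) := by
    intro m hm π hg
    refine (hu'.mono_left hm).sub (tendsto_pi_nhds.2 fun σ => ?_)
    exact (((hfd σ).mono_left hm).mul (hg.apply_nhds σ)).const_mul _
  have hgbd : ∀ σ : G.Face, ∃ C, ∀ᶠ k in l, |G.gradLin (P k) σ| ≤ C := by
    intro σ
    obtain ⟨C, hC⟩ := hgb σ
    have hqσ := faceDensity_pos hγ hq σ
    refine ⟨C / (faceDensity γ q σ / 2), ?_⟩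
    filter_upwards [hC, (hfd σ).eventually (lt_mem_nhds (half_lt_self hqσ))] with k h1 h2
    rw [le_div_iff₀ (half_pos hqσ), mul_comm]
    refine le_trans ?_ h1
    rw [abs_mul, abs_of_pos (faceDensity_pos hγ (hρ k) σ)]
    exact mul_le_mul_of_nonneg_right h2.le (abs_nonneg _)
  choose C hC using hgbd
  obtain ⟨g, ⟨π, rfl, hπ⟩, hg⟩ := exists_tendsto_of_isCompact_of_unique
    (f := fun k => G.gradLin (P k)) (l := l)
    (p := fun g => ∃ π, G.gradLin π = g ∧
      ∀ K, divM γ q (U' - anelasticCorrection γ η δt q π) K = 0)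
    (isCompact_univ_pi fun σ => isCompact_Icc (a := -C σ) (b := C σ))
    ((eventually_all.2 hC).mono fun k hk σ _ => abs_le.1 (hk σ))
    (by
      intro m _ hm g hg
      -- gradients form a closed set, the mesh being finite
      have hmem : g ∈ LinearMap.range G.gradLin :=
        (LinearMap.range G.gradLin).closed_of_finiteDimensional.mem_of_tendsto hg
          (Eventually.of_forall fun k => ⟨P k, rfl⟩)
      obtain ⟨π, rfl⟩ := hmem
      refine ⟨π, rfl, fun K => ?_⟩
      have h1 := ((((hlim.sub hlim').mono_left hm).apply_nhds K).const_mul (1 / δt)).add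
        (tendsto_divM hγ hq (hlim.mono_left hm) (hcorr m hm π hg) K)
      have h2 := tendsto_nhds_unique h1
        ((tendsto_const_nhds (x := (0 : ℝ))).congr fun k => (hmass k K).symm)
      simpa using h2)
    (by
      rintro _ _ ⟨π₁, rfl, h₁⟩ ⟨π₂, rfl, h₂⟩
      exact grad_eq_of_divM_eq_zero hγ hδt hη hq h₁ h₂)
  have hc := hcorr l le_rfl π hg
  refine ⟨fun σ => (dualAvg q σ * U' σ - δt * (1 / σ.vol * upwindFlux γ q
    (U' - anelasticCorrection γ η δt q π) U' σ + faceDensity γ q σ * grad π σ)) / dualAvg q σ,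
    π, tendsto_pi_nhds.2 fun σ => ?_, hπ, fun σ => ?_⟩
  · refine Tendsto.congr (fun k => ?_) ((((tendsto_dualAvg hlim' σ).mul (hu'.apply_nhds σ)).sub
      ((((tendsto_upwindFlux hγ hq hlim hc hu' σ).const_mul (1 / σ.vol)).add
        ((hfd σ).mul (hg.apply_nhds σ))).const_mul δt)).div (tendsto_dualAvg hlim σ)
        (dualAvg_pos hq σ).ne')
    have hpos := dualAvg_pos (hρ k) σ
    have h := hmom k σ
    rw [Pi.div_apply, div_eq_iff hpos.ne', gradLin_apply]
    have e : dualAvg (ρ k) σ * u k σ - dualAvg (ρ' k) σ * u' k σ =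
        δt * (1 / δt * (dualAvg (ρ k) σ * u k σ - dualAvg (ρ' k) σ * u' k σ)) := by
      field_simp
    linear_combination (-δt) * h - e
  · have hpos := dualAvg_pos hq σ
    rw [mul_sub, mul_div_cancel₀ _ hpos.ne']
    field_simp
    ring

end MACGrid

/-! ### Norms in time and space -/

theorem tendsto_supNormTime_of_timeStep {F : ℕ → ℕ → ℝ≥0∞} {T δt : ℝ} {N : ℕ} (hδt : 0 < δt)
    (hT : T = N * δt) (h : ∀ n ≤ N, Tendsto (fun k => F k n) atTop (𝓝 0)) :
    Tendsto (fun k => supNormTime T fun t => F k ⌈t / δt⌉₊) atTop (𝓝 0) := by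
  have hsum : Tendsto (fun k => ∑ n ∈ Finset.range (N + 1), F k n) atTop (𝓝 0) := by
    have := tendsto_finsetSum (Finset.range (N + 1)) fun n hn =>
      h n (Nat.lt_succ_iff.1 (Finset.mem_range.1 hn))
    simpa using this
  refine tendsto_of_tendsto_of_tendsto_of_le_of_le tendsto_const_nhds hsum (fun _ => zero_le)
    fun k => ?_
  refine essSup_le_of_ae_le _ ?_
  filter_upwards [ae_restrict_mem measurableSet_Ioo] with t ht
  refine Finset.single_le_sum (f := F k) (fun _ _ => zero_le) (Finset.mem_range.2 ?_)
  refine Nat.lt_succ_iff.2 (Nat.ceil_le.2 ?_)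
  rw [div_le_iff₀ hδt, ← hT]
  exact ht.2.le

theorem tendsto_seminorm_sub {ι κ : Type*} [Fintype κ] {l : Filter ι} (p : Seminorm ℝ (κ → ℝ))
    {v : ι → κ → ℝ} {v0 : κ → ℝ} (h : Tendsto v l (𝓝 v0)) :
    Tendsto (fun k => ENNReal.ofReal (p (v k - v0))) l (𝓝 0) := by
  classical
  have hsum : Tendsto (fun k => ∑ i, |v k i - v0 i| * p (Pi.single i 1)) l (𝓝 0) := by
    have := tendsto_finsetSum Finset.univ fun i _ =>
      (((h.apply_nhds i).sub_const (v0 i)).abs).mul_const (p (Pi.single i 1))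
    simpa using this
  have hp : Tendsto (fun k => p (v k - v0)) l (𝓝 0) := by
    refine tendsto_of_tendsto_of_tendsto_of_le_of_le tendsto_const_nhds hsum
      (fun _ => apply_nonneg p _) fun k => ?_
    conv_lhs => rw [pi_eq_sum_univ' (v k - v0)]
    refine (Finset.le_sum_of_subadditive p (map_zero p).le (map_add_le_add p) _ _).trans
      (Finset.sum_le_sum fun i _ => ?_)
    rw [map_smul_eq_mul, Real.norm_eq_abs]
    rfl
  simpa using ENNReal.tendsto_ofReal hp

namespace MACGrid

variable {d : ℕ} {M : Type*} {G : MACGrid d M}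

/-- The stability condition forces `η` to be positive as soon as there is a face. -/
theorem eta_pos_of_face {η : ℝ} {q : M → ℝ} (hq : ∀ K, 0 < q K)
    (hη : ∀ σ : G.Face, 1 / dualAvg q σ < η) (σ : G.Face) : 0 < η :=
  (one_div_pos.2 (dualAvg_pos hq σ)).trans (hη σ)

/-- The initial densities are within `O(ε)` of the hydrostatic density. -/
theorem exists_abs_cellAvg_sub_hydro_le {γ C : ℝ} (hγ : 1 < γ) {φ : (Fin d → ℝ) → ℝ}
    (hφ : ContinuousOn φ (closure G.domain)) (hC : ∀ x ∈ closure G.domain, φ x < C)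
    {ε : ℕ → ℝ} (hε : ∀ k, 0 < ε k) {ρ0 : ℕ → (Fin d → ℝ) → ℝ}
    {u0 : ℕ → (Fin d → ℝ) → (Fin d → ℝ)} {U0 : (Fin d → ℝ) → (Fin d → ℝ)}
    (hwp : IsWellPrepared G.domain (hydroDensity γ C φ) ε ρ0 u0 U0) (K : M) :
    ∃ B, ∀ k, |G.cellAvg (ρ0 k) K - G.hydro γ C φ K| ≤ B * ε k := by
  obtain ⟨r, hr, -, ⟨B, hB⟩, -⟩ := hwp.density_expansion
  refine ⟨B, fun k => G.abs_cellAvg_sub_le ?_ (G.integrableOn_hydroDensity hγ hφ hC K) ?_⟩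
  · have : IsFiniteMeasure (volume.restrict (G.closedCell K)) :=
      ⟨by rw [Measure.restrict_apply_univ]; exact (G.isCompact_closedCell K).measure_lt_top⟩
    exact ((hwp.density_memLp k).mono_measure
      (Measure.restrict_mono' (G.closedCell_ae_le_domain K) le_rfl)).integrable le_top
  · filter_upwards [hr k, hB k] with x h1 h2
    rw [h1, add_sub_cancel_left, abs_mul, abs_of_pos (hε k), mul_comm]
    exact mul_le_mul_of_nonneg_right h2 (hε k).le

variable [Fintype M]

theorem tendsto_eLpNorm_toFun_sub {ι : Type*} {l : Filter ι} {v : ι → M → ℝ} {v0 : M → ℝ}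
    (h : Tendsto v l (𝓝 v0)) (p : ℝ≥0∞) :
    Tendsto (fun k => eLpNorm (fun x => G.toFun (v k) x - G.toFun v0 x) p
      (volume.restrict G.domain)) l (𝓝 0) := by
  have hc : volume.restrict G.domain univ ^ p.toReal⁻¹ ≠ ⊤ := by
    refine ENNReal.rpow_ne_top_of_nonneg (by positivity) ?_
    rw [Measure.restrict_apply_univ]
    exact G.volume_domain_lt_top.ne
  have hsum : Tendsto (fun k => ∑ K, |v k K - v0 K|) l (𝓝 0) := by
    have := tendsto_finsetSum Finset.univ fun K _ => ((h.apply_nhds K).sub_const (v0 K)).abs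
    simpa using this
  have h0 := ENNReal.Tendsto.const_mul (ENNReal.tendsto_ofReal hsum) (Or.inr hc)
  rw [ENNReal.ofReal_zero, mul_zero] at h0
  refine tendsto_of_tendsto_of_tendsto_of_le_of_le tendsto_const_nhds h0 (fun _ => zero_le)
    fun k => eLpNorm_le_of_ae_bound (Eventually.of_forall fun x => ?_)
  rw [toFun, toFun, ← Finset.sum_sub_distrib]
  refine (norm_sum_le _ _).trans (Finset.sum_le_sum fun K _ => ?_)
  by_cases hx : x ∈ G.closedCell K <;> simp [hx]

/-! ### The compressible scheme in terms of the scaled potential -/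

namespace IsEulerSolution

variable {γ C η δt ε : ℝ} {φ : (Fin d → ℝ) → ℝ} {N : ℕ} {ρ0 : (Fin d → ℝ) → ℝ}
  {u0 : (Fin d → ℝ) → (Fin d → ℝ)} {ρ : ℕ → M → ℝ} {u : ℕ → G.Face → ℝ}

theorem mass_scaled (h : G.IsEulerSolution γ C φ η δt N ε ρ0 u0 ρ u) (hγ : 1 < γ) {n : ℕ}
    (hn : n < N) (K : M) :
    1 / δt * (ρ (n + 1) K - ρ n K) + divM γ (ρ (n + 1)) (u n - anelasticCorrection γ η δt
      (ρ (n + 1)) (scaledPotential γ ε (G.hydro γ C φ) (ρ (n + 1)))) K = 0 := by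
  rw [← correction_eq_anelasticCorrection hγ (h.pos n hn)]
  exact h.mass n hn K

theorem momentum_scaled (h : G.IsEulerSolution γ C φ η δt N ε ρ0 u0 ρ u) (hγ : 1 < γ) {n : ℕ}
    (hn : n < N) (σ : G.Face) :
    1 / δt * (dualAvg (ρ (n + 1)) σ * u (n + 1) σ - dualAvg (ρ n) σ * u n σ) +
      1 / σ.vol * upwindFlux γ (ρ (n + 1)) (u n - anelasticCorrection γ η δt
        (ρ (n + 1)) (scaledPotential γ ε (G.hydro γ C φ) (ρ (n + 1)))) (u n) σ +
      faceDensity γ (ρ (n + 1)) σ *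
        grad (scaledPotential γ ε (G.hydro γ C φ) (ρ (n + 1))) σ = 0 := by
  rw [← correction_eq_anelasticCorrection hγ (h.pos n hn),
    ← grad_pressure_add hγ (h.pos n hn)]
  linear_combination h.momentum n hn σ

end IsEulerSolution

end MACGrid

/-! ### The low Mach number limit -/

theorem mainTheorem4 {d : ℕ} {M : Type*} [Fintype M] (G : MACGrid d M)
    (γ : ℝ) (hγ : 1 < γ)
    (φ : (Fin d → ℝ) → ℝ) (hφ : ContinuousOn φ (closure G.domain))
    (C : ℝ) (hC : ∀ x ∈ closure G.domain, φ x < C)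
    (T δt : ℝ) (N : ℕ) (hδt : 0 < δt) (hT : T = N * δt)
    (η : ℝ) (hη : ∀ σ : G.Face, 1 / MACGrid.dualAvg (G.hydro γ C φ) σ < η)
    (ε : ℕ → ℝ) (hε : ∀ k, 0 < ε k) (hε0 : Tendsto ε atTop (𝓝 0))
    (ρ0 : ℕ → (Fin d → ℝ) → ℝ) (u0 : ℕ → (Fin d → ℝ) → (Fin d → ℝ))
    (U0 : (Fin d → ℝ) → (Fin d → ℝ))
    (hwp : IsWellPrepared G.domain (hydroDensity γ C φ) ε ρ0 u0 U0)
    (ρ : ℕ → ℕ → M → ℝ) (u : ℕ → ℕ → G.Face → ℝ)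
    (hsol : ∀ k, G.IsEulerSolution γ C φ η δt N (ε k) (ρ0 k) (u0 k) (ρ k) (u k)) :
    (∀ r : ℝ, 1 < r → r ≤ min 2 γ →
      Tendsto (fun k => supNormTime T fun t =>
          eLpNorm (fun x => G.toFun (timeStep δt (ρ k) t) x - G.toFun (G.hydro γ C φ) x)
            (ENNReal.ofReal r) (volume.restrict G.domain))
        atTop (𝓝 0)) ∧
    (∀ p : Seminorm ℝ (M → ℝ),
      Tendsto (fun k => supNormTime T fun t =>
          ENNReal.ofReal (p (timeStep δt (ρ k) t - G.hydro γ C φ)))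
        atTop (𝓝 0)) ∧
    Tendsto (fun k => ρ k 0) atTop (𝓝 (G.hydro γ C φ)) ∧
    ∃ (π : ℕ → M → ℝ) (U : ℕ → G.Face → ℝ),
      (∀ p : Seminorm ℝ (G.Face → ℝ),
        Tendsto (fun k => supNormTime T fun t =>
            ENNReal.ofReal (p (timeStep δt (u k) t - timeStep δt U t)))
          atTop (𝓝 0)) ∧
      Tendsto (fun k => u k 0) atTop (𝓝 (U 0)) ∧
      G.IsAnelasticSolution γ (G.hydro γ C φ) η δt N U0 π U := by
  have hq := G.hydro_pos hγ hφ hC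
  have hη' := MACGrid.eta_pos_of_face hq hη
  have hinit : ∀ K, ∃ B, ∀ᶠ k in atTop, |ρ k 0 K - G.hydro γ C φ K| ≤ B * ε k := fun K => by
    obtain ⟨B, hB⟩ := MACGrid.exists_abs_cellAvg_sub_hydro_le hγ hφ hC hε hwp K
    refine ⟨B, Eventually.of_forall fun k => ?_⟩
    rw [(hsol k).init_density]
    exact hB k
  have hfin : IsFiniteMeasure (volume.restrict G.domain) :=
    ⟨by rw [Measure.restrict_apply_univ]; exact G.volume_domain_lt_top⟩
  have hinit_u : Tendsto (fun k => u k 0) atTop (𝓝 (G.faceAvg U0)) :=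
    (MACGrid.tendsto_faceAvg (fun k => (hwp.velocity_memLp k).mono_exponent le_top)
      hwp.limit_memLp hwp.velocity_tendsto).congr fun k => (hsol k).init_velocity.symm
  -- both convergences propagate from one time level to the next, so that induction applies
  have hstep : ∀ n < N, (∀ K, ∃ B, ∀ᶠ k in atTop, |ρ k n K - G.hydro γ C φ K| ≤ B * ε k) →
      ∀ V, Tendsto (fun k => u k n) atTop (𝓝 V) → _ := fun n hn hb V hV =>
    MACGrid.step_limit (l := atTop) hγ hδt hη' hε hε0 hq (fun k => (hsol k).pos n hn)
      (fun k => (hsol k).mass_scaled hγ hn) (fun k => (hsol k).momentum_scaled hγ hn) hb hV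
  have hconv : ∀ n ≤ N, (∀ K, ∃ B, ∀ᶠ k in atTop, |ρ k n K - G.hydro γ C φ K| ≤ B * ε k) ∧
      ∃ V, Tendsto (fun k => u k n) atTop (𝓝 V) := by
    intro n
    induction n with
    | zero => exact fun _ => ⟨hinit, _, hinit_u⟩
    | succ n ih =>
      intro hn
      obtain ⟨hb, V, hV⟩ := ih (Nat.le_of_succ_le hn)
      obtain ⟨hb', V', -, hV', -⟩ := hstep n hn hb V hV
      exact ⟨hb', V', hV'⟩
  have hρ : ∀ n ≤ N, Tendsto (fun k => ρ k n) atTop (𝓝 (G.hydro γ C φ)) := fun n hn =>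
    tendsto_pi_nhds.2 fun K =>
      tendsto_of_eventually_abs_sub_le_mul hε0 ((hconv n hn).1 K).choose_spec
  choose! U hU using fun n hn => (hconv n hn).2
  have hπ : ∀ n < N, ∃ π : M → ℝ,
      (∀ K, MACGrid.divM γ (G.hydro γ C φ)
        (U n - MACGrid.anelasticCorrection γ η δt (G.hydro γ C φ) π) K = 0) ∧
      ∀ σ : G.Face, 1 / δt * (MACGrid.dualAvg (G.hydro γ C φ) σ * (U (n + 1) σ - U n σ)) +
        1 / σ.vol * MACGrid.upwindFlux γ (G.hydro γ C φ)
          (U n - MACGrid.anelasticCorrection γ η δt (G.hydro γ C φ) π) (U n) σ +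
        MACGrid.faceDensity γ (G.hydro γ C φ) σ * MACGrid.grad π σ = 0 := by
    intro n hn
    obtain ⟨-, V, π, hV, h1, h2⟩ := hstep n hn (hconv n hn.le).1 (U n) (hU n hn.le)
    rw [tendsto_nhds_unique hV (hU (n + 1) hn)] at h2
    exact ⟨π, h1, h2⟩
  choose! π hmass hmom using hπ
  -- the value of the pressure at time zero is arbitrary, whence the shift of `π`
  refine ⟨fun r _ _ => ?_, fun p => ?_, hρ 0 N.zero_le, fun n => π (n - 1), U, fun p => ?_,
    hU 0 N.zero_le, tendsto_nhds_unique (hU 0 N.zero_le) hinit_u, hmass, hmom⟩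
  · exact tendsto_supNormTime_of_timeStep
      (F := fun k n => eLpNorm (fun x => G.toFun (ρ k n) x - G.toFun (G.hydro γ C φ) x)
        (ENNReal.ofReal r) (volume.restrict G.domain)) hδt hT
      fun n hn => MACGrid.tendsto_eLpNorm_toFun_sub (hρ n hn) _
  · exact tendsto_supNormTime_of_timeStep
      (F := fun k n => ENNReal.ofReal (p (ρ k n - G.hydro γ C φ))) hδt hT
      fun n hn => tendsto_seminorm_sub p (hρ n hn)
  · exact tendsto_supNormTime_of_timeStep
      (F := fun k n => ENNReal.ofReal (p (u k n - U n))) hδt hT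
      fun n hn => tendsto_seminorm_sub p (hU n hn)
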